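/- **Network.** $n$ users form a square grid in the unit square with spacing $1/\sqrt n$. Under the protocol model with range $r<\sqrt2$, guard parameter $\Delta>0$ and link rate $C_r>0$ (bits per channel use), a user $v$ receives the transmission of a user $u$ iff $v$ is at distance at most $r$ from $u$ and at distance at least $(1+\Delta)r$ from every other transmitting user. The users are divided into clusters of $g_c$ users each, any two users of one cluster being within distance $r$, and the clusters are grouped into $\mathcal K$ reuse sets such that the clusters of one set can be active simultaneously without interference. There are $m$ files of $F$ bits, every user caches at most $MF$ bits and requests one file. A throughput $T$ is achievable if there are schemes, with file sizes $F\to\infty$ and vanishing worst-case error probability, that serve all requests within $F/T$ channel uses of a feasible transmission policy; a scheme achieves the throughput $T_c$ if every $T<T_c$ is achievable by it. **Scheme.** A $(\gamma,\tau)$-Ruzsa–Szemerédi (RS) graph is a graph whose edge set is a union of $\tau$ pairwise disjoint induced matchings of $\gamma$ edges each. In the clustered RS scheme over such a graph with $g_c$ vertices, the users of each cluster are identified with the vertices, each file is split into $K=(2\gamma-1)g_c$ packets, each vertex represents $2\gamma-1$ of them, and a user caches, for every file, the packets of all vertices not adjacent to its own vertex (its own included). For each of the $\tau$ matchings, each of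 its $2\gamma$ nodes multicasts to its cluster the XOR of $2\gamma-1$ packets, one for each other node $x$ of the matching, taken from the file requested by $x$ and from the packets represented by the partner of $x$ in the matching; distinct transmitters use distinct packets for the same $x$. The rate of a cluster is $R_c=\frac{\tau}{g_c}\frac{2\gamma}{2\gamma-1}$, and the throughput of the scheme is $$T_c^{\rm RS}=\frac{C_r}{\mathcal K R_c}=\frac{C_r}{\mathcal K}\,\frac{g_c}{\tau}\,\frac{2\gamma-1}{2\gamma}.$$ **Statement.** There are constants $c_1,c_2>0$ such that the following holds for every integer $\Lambda>10.5^2$ with $\delta=\frac{2\ln 10.5}{\ln\Lambda}$. For $g_c=\Lambda^z$, $z\to\infty$, there are RS graphs on $g_c$ vertices such that $K=O(g_c^{2-\delta})$, $$T_c^{\rm RS}=\frac{C_r}{\mathcal K}\,g_c^{-\delta}+o\!\left(\frac{C_r}{\mathcal K}\,g_c^{-\delta}\right),$$ and, for all sufficiently large $z$ and all networks, clusterings and reuse sets as above with cluster size $g_c$, the clustered RS scheme over these graphs achieves the throughput $T_c^{\rm RS}$ with the cache size $M=2m\,g_c^{-c_1\delta\exp(-c_2/\delta)}$, provided that $t_c=g_cM/m\ge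 2$. -/

import Mathlib

open Filter Asymptotics
open scoped Classical

noncomputable section

namespace D2D

/-! ### Ruzsa–Szemerédi graphs -/

/-- A `(γ, τ)`-Ruzsa–Szemerédi graph on the vertex set `V`: its edge set is the union of `τ`
pairwise (edge-)disjoint induced matchings, each consisting of `γ` edges. -/
structure RSGraph (V : Type) (γ τ : ℕ) where
  graph : SimpleGraph V
  matching : Fin τ → graph.Subgraph
  isMatching : ∀ s, (matching s).IsMatching
  isInduced : ∀ s, (matching s).IsInduced
  card_edges : ∀ s, (matching s).edgeSet.ncard = γ
  disjoint_edges : ∀ s s', s ≠ s' → Disjoint (matching s).edgeSet (matching s').edgeSet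
  cover : (⋃ s, (matching s).edgeSet) = graph.edgeSet

/-! ### Caching schemes

The set of users is `U`. There are `m` files; each file is split into equally sized packets indexed
by `P` (so `K = Fintype.card P`), each of `ℓ` bits, hence a file has `F = K * ℓ` bits. -/

/-- A realization of all the files of the library. -/
abbrev Library (P : Type) (m ℓ : ℕ) : Type := Fin m → P → Fin ℓ → ZMod 2

/-- Cache placement and encoding functions of a D2D caching scheme.
* `cached u` is the set of packets (file, packet index) stored by user `u`;
* `rx u` is the set of users whose transmitted messages are received by user `u`;
* `Idx f u` indexes the bits transmitted by user `u` when the demand vector is `f`;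
* `enc f u` computes these bits from the cache content of `u`. -/
structure Scheme (U P : Type) (m ℓ : ℕ) where
  cached : U → Finset (Fin m × P)
  rx : U → Finset U
  Idx : (U → Fin m) → U → Type
  finite_idx : ∀ f u, Finite (Idx f u)
  enc : ∀ (f : U → Fin m) (u : U),
    ({p : Fin m × P // p ∈ cached u} → Fin ℓ → ZMod 2) → Idx f u → ZMod 2

namespace Scheme

variable {U P : Type} {m ℓ : ℕ}

/-- The cache content of user `u`. -/
def cacheContent (S : Scheme U P m ℓ) (W : Library P m ℓ) (u : U) :
    {p : Fin m × P // p ∈ S.cached u} → Fin ℓ → ZMod 2 :=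
  fun p => W p.1.1 p.1.2

/-- The message transmitted by user `u`. -/
def message (S : Scheme U P m ℓ) (W : Library P m ℓ) (f : U → Fin m) (u : U) :
    S.Idx f u → ZMod 2 :=
  S.enc f u (S.cacheContent W u)

/-- The number of bits transmitted by user `u`. -/
def numBits (S : Scheme U P m ℓ) (f : U → Fin m) (u : U) : ℕ := Nat.card (S.Idx f u)

/-- Decoding functions: user `u` estimates a file from the messages it receives, its own cache
content and the demand vector. -/
def Decoder (S : Scheme U P m ℓ) : Type :=
  ∀ (f : U → Fin m) (u : U), (∀ v : {v : U // v ∈ S.rx u}, S.Idx f v.1 → ZMod 2) →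
    ({p : Fin m × P // p ∈ S.cached u} → Fin ℓ → ZMod 2) → P → Fin ℓ → ZMod 2

/-- The estimate, by user `u`, of the file it requested. -/
def estimate (S : Scheme U P m ℓ) (dec : S.Decoder) (W : Library P m ℓ) (f : U → Fin m) (u : U) :
    P → Fin ℓ → ZMod 2 :=
  dec f u (fun v => S.message W f v.1) (S.cacheContent W u)

/-- Worst-case error probability over all demands and users; the files are independent and
uniformly distributed. -/
def errorProb [Fintype P] (S : Scheme U P m ℓ) (dec : S.Decoder) : ℝ :=
  ⨆ (f : U → Fin m) (u : U),
    (Nat.card {W : Library P m ℓ // S.estimate dec W f u ≠ W (f u)} : ℝ) /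
      Nat.card (Library P m ℓ)

end Scheme

/-! ### The wireless network -/

/-- The `n = s ^ 2` users of a square grid. -/
abbrev Users (s : ℕ) : Type := Fin s × Fin s

/-- The position of a user in the unit square; neighbouring users have distance `1 / s = 1 / √n`. -/
def pos {s : ℕ} (u : Users s) : EuclideanSpace ℝ (Fin 2) :=
  !₂[((u.1 : ℕ) : ℝ) / s, ((u.2 : ℕ) : ℝ) / s]

/-- A set of simultaneously active directed links (transmitter, receiver) which does not violate
the protocol model: each receiver is at distance at most `r` from its transmitter, and at distance
at least `(1 + Δ) r` from every other transmitting user. -/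
def Feasible {s : ℕ} (r Δ : ℝ) (A : Finset (Users s × Users s)) : Prop :=
  ∀ a ∈ A, a.1 ≠ a.2 ∧ dist (pos a.1) (pos a.2) ≤ r ∧
    ∀ b ∈ A, b.1 ≠ a.1 → (1 + Δ) * r ≤ dist (pos a.2) (pos b.1)

/-- For the demand vector `f`, all transmitted messages of the scheme can be delivered to all
their receivers in `D` channel uses by a feasible transmission policy. `act t` is the set of active
links in channel use `t`; `slot u` is the set of channel uses in which user `u` transmits its
message, `C` bits per channel use, and all the users that are to receive it are then listening. -/
def DeliverableIn {s : ℕ} {P : Type} {m ℓ : ℕ} (r Δ C : ℝ) (S : Scheme (Users s) P m ℓ)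
    (f : Users s → Fin m) (D : ℕ) : Prop :=
  ∃ act : ℕ → Finset (Users s × Users s), (∀ t, Feasible r Δ (act t)) ∧
    ∃ slot : Users s → Finset ℕ, ∀ u,
      slot u ⊆ Finset.range D ∧
      (S.numBits f u : ℝ) ≤ C * (slot u).card ∧
      ∀ t ∈ slot u, ∀ v, u ∈ S.rx v → (u, v) ∈ act t

/-- The pair `(M, T)` of cache size (in files) and per-user throughput is achievable by schemes of
the class `𝒮`: for every `ε > 0` there is a sequence of schemes in `𝒮`, with file sizes
`F → ∞`, such that each user caches at most `M F` bits (`M K` packets), the total rate (transmitted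
bits over `F`) stays bounded, the worst-case error probability is eventually at most `ε`, and all
requests are served in `D ≤ F / T` channel uses. -/
def ThroughputAchievable (s : ℕ) (r Δ C : ℝ) (P : Type) [Fintype P] (m : ℕ)
    (𝒮 : ∀ ℓ, Scheme (Users s) P m ℓ → Prop) (M T : ℝ) : Prop :=
  ∀ ε : ℝ, 0 < ε → ∃ (ℓ : ℕ → ℕ) (S : ∀ k, Scheme (Users s) P m (ℓ k))
    (dec : ∀ k, (S k).Decoder) (R : ℝ),
    (∀ k, 𝒮 (ℓ k) (S k)) ∧
    Tendsto (fun k => Fintype.card P * ℓ k) atTop atTop ∧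
    (∀ k u, (((S k).cached u).card : ℝ) ≤ M * Fintype.card P) ∧
    (∀ᶠ k in atTop, (S k).errorProb (dec k) ≤ ε) ∧
    (∀ᶠ k in atTop, ∀ f, ∑ u, ((S k).numBits f u : ℝ) ≤ R * ((Fintype.card P * ℓ k : ℕ) : ℝ)) ∧
    (∀ᶠ k in atTop, ∀ f, ∃ D : ℕ, DeliverableIn r Δ C (S k) f D ∧
      (D : ℝ) * T ≤ ((Fintype.card P * ℓ k : ℕ) : ℝ))

/-- A division of the users into `c` clusters of `g` users each, such that any two users of the
same cluster are within the transmission range `r`. The user number `i` of cluster number `k` is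
`toEquiv.symm (k, i)`. -/
structure Clustering (s c g : ℕ) (r : ℝ) where
  toEquiv : Users s ≃ Fin c × Fin g
  dist_le : ∀ k i j, dist (pos (toEquiv.symm (k, i))) (pos (toEquiv.symm (k, j))) ≤ r

/-- The clusters are grouped into `κ` reuse sets (`col k` is the reuse set of cluster `k`), where
the clusters of the same reuse set can be active simultaneously without interference. -/
def IsReuse {s c g κ : ℕ} {r : ℝ} (Δ : ℝ) (cl : Clustering s c g r) (col : Fin c → Fin κ) : Prop :=
  ∀ k k', k ≠ k' → col k = col k' →
    ∀ i j, (1 + Δ) * r ≤ dist (pos (cl.toEquiv.symm (k, i))) (pos (cl.toEquiv.symm (k', j)))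

/-! ### The clustered Ruzsa–Szemerédi scheme -/

/-- A labelling `lab s x w` of the transmitters `w` for the receiver `x` within the matching `s`:
distinct nodes `w ≠ x` of the matching send to `x` distinct ones of the `2γ - 1` packets
represented by the partner of `x`. -/
def IsLabelling {V : Type} {γ τ : ℕ} (H : RSGraph V γ τ)
    (lab : Fin τ → V → V → Fin (2 * γ - 1)) : Prop :=
  ∀ s, ∀ x ∈ (H.matching s).verts, Set.InjOn (lab s x) ((H.matching s).verts \ {x})

/-- The packet `p`, read from a cache content (a cached packet in all the uses below). -/
def readPacket {Q : Type} {ℓ : ℕ} {A : Finset Q} (c : {p : Q // p ∈ A} → Fin ℓ → ZMod 2) (p : Q) :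
    Fin ℓ → ZMod 2 :=
  if h : p ∈ A then c ⟨p, h⟩ else 0

/-- The RS graph scheme applied to each cluster; `e` gives the cluster of a user and its vertex
in the graph. The packets of a file are indexed by `V × Fin (2 * γ - 1)`: every vertex represents
`2γ - 1` packets. A user caches the packets of all vertices which are not adjacent to its own vertex
(its own vertex included). For each matching which contains its vertex `w`, a user multicasts to
its cluster the XOR, over the other nodes `x` of the matching, of one packet of the file
requested by `x`, which belongs to the partner `y` of `x` in the matching. -/
def rsScheme {U ι V : Type} [Fintype U] [Fintype V] {γ τ : ℕ} (e : U ≃ ι × V)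
    (H : RSGraph V γ τ) (lab : Fin τ → V → V → Fin (2 * γ - 1)) (m ℓ : ℕ) :
    Scheme U (V × Fin (2 * γ - 1)) m ℓ where
  cached u := {p | ¬ H.graph.Adj (e u).2 p.2.1}
  rx u := {v | v ≠ u ∧ (e v).1 = (e u).1}
  Idx _ u := {s : Fin τ // (e u).2 ∈ (H.matching s).verts} × Fin ℓ
  finite_idx _ _ := inferInstance
  enc f u c b :=
    ∑ x : V with x ∈ (H.matching b.1.1).verts ∧ x ≠ (e u).2,
      ∑ y : V with (H.matching b.1.1).Adj x y,
        readPacket c (f (e.symm ((e u).1, x)), (y, lab b.1.1 x (e u).2)) b.2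

/-- The class of the clustered RS schemes over a given RS graph. -/
def IsClusteredRS {s c g γ τ : ℕ} {r : ℝ} (cl : Clustering s c g r) (H : RSGraph (Fin g) γ τ)
    (m ℓ : ℕ) (S : Scheme (Users s) (Fin g × Fin (2 * γ - 1)) m ℓ) : Prop :=
  ∃ lab, IsLabelling H lab ∧ S = rsScheme cl.toEquiv H lab m ℓ

/-- The throughput `C / (R_c 𝒦)` of the clustered RS scheme with clusters of `g` users, link rate
`C` and reuse factor `κ`, where `R_c = (τ / g) * (2γ / (2γ - 1))` is the rate in each cluster. -/
def rsThroughput (C : ℝ) (κ g γ τ : ℕ) : ℝ :=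
  C / (((τ : ℝ) / g * (2 * γ / (2 * γ - 1))) * κ)

end D2D

end

namespace D2D

/-! In an induced matching a node is adjacent to no node of the matching but its partner. Hence a
transmitter caches every packet it must XOR, and a receiver caches every summand except its own, so
decoding never fails (`rsScheme_decodable`). Time division over reuse sets and positions in a
cluster delivers the messages (`throughputAchievable_rs`). The cache of a user is proportional to
its number of non-neighbours, so a bound at every vertex is required, not just on average. If the
graph on `N = Λ ^ z` vertices is nearly complete, the degree sum `2γτ` is about `N ^ 2`, and the
throughput is about `(C / 𝒦) (2γ - 1) / N`. Matchings of about `N / (2 · 110.25 ^ z)` edges, with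
`110.25 = 10.5 ^ 2 = Λ ^ δ`, turn this into `(C / 𝒦) N ^ (-δ)`.

The graphs come from the grid `{0, …, Λ - 1} ^ n`. Squared distances concentrate around a mean `μ`
(`exists_card_typicalPairs_ge`). Join the pairs at typical distance and sort the edges into classes
by the sum of their ends. Two edges of one class are the diagonals of a parallelogram, so if one
side is also typical, the adjacent side is short (`sqDist_le_of_typicalPairs`). Balls of that radius
have at most `8 ^ n` points, so an edge conflicts with few edges of its class, and conflict-free
edges of one class form an induced matching.

It remains to cut the classes into matchings of exactly `γ` edges while losing few edges at each
vertex. `exists_core` keeps a set of vertices, at least half of them with the parameters chosen,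
whose pairs mostly lie in populous classes; `exists_two_to_one` restores the number of vertices by
duplication. In each populous class a reserve is set aside which meets no vertex too often
(`exists_subset_load_le`), and `exists_blocks` covers everything outside the reserve, completing
short matchings from it. Only reserve edges can be lost. -/

theorem ncard_verts_of_isMatching {V : Type} [Fintype V] {G : SimpleGraph V} {M : G.Subgraph}
    (hM : M.IsMatching) : M.verts.ncard = 2 * M.edgeSet.ncard := by
  have h1 := M.spanningCoe.sum_degrees_eq_twice_card_edges
  have h2 : ∀ v, M.spanningCoe.degree v = if v ∈ M.verts then 1 else 0 := by
    intro v
    rw [← SimpleGraph.card_neighborFinset_eq_degree]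
    split_ifs with hv
    · obtain ⟨w, hw, hu⟩ := hM hv
      rw [Finset.card_eq_one]
      refine ⟨w, ?_⟩
      ext x
      simp only [SimpleGraph.mem_neighborFinset, SimpleGraph.Subgraph.spanningCoe_adj,
        Finset.mem_singleton]
      exact ⟨fun h => hu x h, fun h => h ▸ hw⟩
    · rw [Finset.card_eq_zero, Finset.eq_empty_iff_forall_notMem]
      intro x hx
      simp only [SimpleGraph.mem_neighborFinset, SimpleGraph.Subgraph.spanningCoe_adj] at hx
      exact hv (M.edge_vert hx)
  simp only [h2, Finset.sum_boole] at h1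
  rw [Set.ncard_eq_toFinset_card', Set.ncard_eq_toFinset_card']
  have h3 : M.spanningCoe.edgeFinset = M.edgeSet.toFinset := by
    ext e
    induction e with | _ a b => simp
  rw [← h3, ← h1, Nat.cast_id]
  congr 1
  ext
  simp

/-! ### Degrees and labellings in Ruzsa–Szemerédi graphs -/

namespace RSGraph

variable {V : Type} {γ τ : ℕ}

theorem exists_matching_adj (H : RSGraph V γ τ) {x y : V} (h : H.graph.Adj x y) :
    ∃ s, (H.matching s).Adj x y := by
  have : s(x, y) ∈ ⋃ s, (H.matching s).edgeSet := by rw [H.cover]; exact h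
  simpa using this

theorem matching_unique (H : RSGraph V γ τ) {x y : V} {s s' : Fin τ}
    (h : (H.matching s).Adj x y) (h' : (H.matching s').Adj x y) : s = s' := by
  by_contra hne
  exact Set.disjoint_left.1 (H.disjoint_edges s s' hne)
    (show s(x, y) ∈ _ from h) (show s(x, y) ∈ _ from h')

theorem ncard_verts [Fintype V] (H : RSGraph V γ τ) (s : Fin τ) :
    (H.matching s).verts.ncard = 2 * γ := by
  rw [ncard_verts_of_isMatching (H.isMatching s), H.card_edges]

/-- The number of matchings through a vertex is its degree. -/
theorem card_matchings_eq [Fintype V] (H : RSGraph V γ τ) (w : V) :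
    Nat.card {s : Fin τ // w ∈ (H.matching s).verts} = Nat.card {v // H.graph.Adj w v} := by
  refine Nat.card_eq_of_bijective
    (fun s => ⟨(H.isMatching s.1 s.2).choose,
      (H.matching s.1).adj_sub (H.isMatching s.1 s.2).choose_spec.1⟩) ⟨?_, ?_⟩
  · intro s s' h
    simp only [Subtype.mk.injEq] at h
    have h1 := (H.isMatching s.1 s.2).choose_spec.1
    have h2 := (H.isMatching s'.1 s'.2).choose_spec.1
    simp only at h1 h2
    rw [← h] at h2
    exact Subtype.ext (H.matching_unique h1 h2)
  · rintro ⟨v, hv⟩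
    obtain ⟨s, hs⟩ := H.exists_matching_adj hv
    have hw := (H.matching s).edge_vert hs
    exact ⟨⟨s, hw⟩, Subtype.ext ((H.isMatching s hw).choose_spec.2 v hs).symm⟩

/-- Double counting of incidences between vertices and matchings. It bounds the transmitted bits in
a cluster and, since the summands are degrees, it also yields the asymptotics of `2γτ`. -/
theorem sum_card_matchings [Fintype V] (H : RSGraph V γ τ) :
    ∑ w, Nat.card {s : Fin τ // w ∈ (H.matching s).verts} = 2 * γ * τ := by
  have : ∀ w, Nat.card {s : Fin τ // w ∈ (H.matching s).verts}
      = ∑ s : Fin τ, if w ∈ (H.matching s).verts then 1 else 0 := by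
    intro w
    rw [Nat.card_eq_fintype_card, Fintype.card_subtype, Finset.sum_boole, Nat.cast_id]
  simp only [this]
  rw [Finset.sum_comm]
  have h : ∀ s, (∑ w, if w ∈ (H.matching s).verts then 1 else 0) = 2 * γ := by
    intro s
    rw [← H.ncard_verts s, Set.ncard_eq_toFinset_card', Finset.sum_boole, Nat.cast_id]
    congr 1
    ext; simp
  simp [h, mul_comm]

/-- A matching has `2γ` nodes, so the `2γ - 1` nodes other than `x` exactly fit the available
labels. -/
theorem exists_isLabelling [Fintype V] (H : RSGraph V γ τ) (hγ : 0 < γ) :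
    ∃ lab, IsLabelling H lab := by
  have : ∀ (s : Fin τ) (x : V), ∃ g : V → Fin (2 * γ - 1),
      x ∈ (H.matching s).verts → Set.InjOn g ((H.matching s).verts \ {x}) := by
    intro s x
    have : Nonempty (Fin (2 * γ - 1)) := ⟨⟨0, by omega⟩⟩
    by_cases hx : x ∈ (H.matching s).verts
    · have hc : ((H.matching s).verts \ {x}).ncard = 2 * γ - 1 := by
        rw [Set.ncard_sdiff_singleton_of_mem hx, H.ncard_verts]
      obtain ⟨g, hg, hg'⟩ := Set.Finite.exists_injOn_of_encard_le
        (s := (H.matching s).verts \ {x}) (t := (Set.univ : Set (Fin (2 * γ - 1))))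
        (Set.toFinite _) (by
          rw [← Set.Finite.cast_ncard_eq (Set.toFinite _), hc]; simp)
      exact ⟨g, fun _ => hg'⟩
    · exact ⟨fun _ => Classical.arbitrary _, fun h => absurd h hx⟩
  choose g hg using this
  exact ⟨g, fun s x hx => hg s x hx⟩

end RSGraph

/-! ### Decoding -/

section Decoding

variable {U ι V : Type} [Fintype U] [Fintype V] {γ τ m ℓ : ℕ}

theorem readPacket_eq {Q : Type} {ℓ : ℕ} {A : Finset Q} (W : Q → Fin ℓ → ZMod 2) {p : Q}
    (hp : p ∈ A) : readPacket (fun q : {p : Q // p ∈ A} => W q.1) p = W p := by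
  simp [readPacket, hp]

/-- The cache content and the received messages determine the requested file. -/
theorem rsScheme_decodable (e : U ≃ ι × V) (H : RSGraph V γ τ)
    {lab : Fin τ → V → V → Fin (2 * γ - 1)} (hlab : IsLabelling H lab)
    (W W' : Library (V × Fin (2 * γ - 1)) m ℓ) (f : U → Fin m) (u : U)
    (hc : (rsScheme e H lab m ℓ).cacheContent W u = (rsScheme e H lab m ℓ).cacheContent W' u)
    (hm : ∀ v ∈ (rsScheme e H lab m ℓ).rx u,
      (rsScheme e H lab m ℓ).message W f v = (rsScheme e H lab m ℓ).message W' f v) :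
    W (f u) = W' (f u) := by
  have hcache : ∀ i y j, ¬ H.graph.Adj (e u).2 y → W i (y, j) = W' i (y, j) := by
    intro i y j h
    have hmem : (i, (y, j)) ∈ (rsScheme e H lab m ℓ).cached u := by simp [rsScheme, h]
    exact congrFun hc ⟨_, hmem⟩
  funext ⟨y, j⟩
  by_cases hadj : H.graph.Adj (e u).2 y
  swap
  · exact hcache _ _ _ hadj
  obtain ⟨s, hs⟩ := H.exists_matching_adj hadj
  have hw := (H.matching s).edge_vert hs
  -- The labelling is injective on `2γ - 1` nodes with `2γ - 1` values, so each missing packet index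
  -- is sent by some node of the matching.
  have hsurj : Set.SurjOn (lab s (e u).2) ((H.matching s).verts \ {(e u).2}) Set.univ := by
    refine (Set.eq_of_subset_of_ncard_le (Set.subset_univ _) ?_).ge
    rw [(hlab s _ hw).ncard_image, Set.ncard_sdiff_singleton_of_mem hw, H.ncard_verts]
    simp
  obtain ⟨w', ⟨hw', hne⟩, hj⟩ := hsurj (Set.mem_univ j)
  obtain ⟨v, hv⟩ : ∃ v, e v = ((e u).1, w') := ⟨e.symm ((e u).1, w'), by simp⟩
  have hv2 : (e v).2 = w' := by rw [hv]
  have hv1 : (e v).1 = (e u).1 := by rw [hv]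
  have hne' : w' ≠ (e u).2 := hne
  have hrx : v ∈ (rsScheme e H lab m ℓ).rx u := by
    simp only [rsScheme, Finset.mem_filter, Finset.mem_univ, true_and]
    refine ⟨?_, hv1⟩
    rintro rfl
    exact hne' hv2.symm
  -- Inducedness at the transmitter: everything it sends is in its cache, so the default `0` of
  -- `readPacket` never occurs.
  have hpart : ∀ x z, x ≠ w' → (H.matching s).Adj x z → ¬ H.graph.Adj w' z := by
    intro x z hx hxz h
    have := H.isInduced s hw' ((H.matching s).edge_vert hxz.symm) h
    exact hx ((H.isMatching s).eq_of_adj_right hxz this)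
  -- Inducedness at the receiver: all summands meant for other nodes are in its cache and cancel.
  have hpart' : ∀ x z, x ≠ (e u).2 → (H.matching s).Adj x z → ¬ H.graph.Adj (e u).2 z := by
    intro x z hx hxz h
    have := H.isInduced s hw ((H.matching s).edge_vert hxz.symm) h
    exact hx ((H.isMatching s).eq_of_adj_right hxz this)
  funext b
  have hmsg := congrFun (hm v hrx) (⟨s, by rw [hv2]; exact hw'⟩, b)
  let T : Library (V × Fin (2 * γ - 1)) m ℓ → V → ZMod 2 := fun W x =>
    ∑ z : V with (H.matching s).Adj x z, W (f (e.symm ((e u).1, x))) (z, lab s x w') b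
  have hT : ∀ W : Library (V × Fin (2 * γ - 1)) m ℓ,
      (rsScheme e H lab m ℓ).message W f v (⟨s, by rw [hv2]; exact hw'⟩, b)
        = ∑ x : V with x ∈ (H.matching s).verts ∧ x ≠ w', T W x := by
    intro W
    simp only [Scheme.message, rsScheme, T, hv2, hv1]
    refine Finset.sum_congr rfl fun x hx => Finset.sum_congr rfl fun z hz => ?_
    simp only [Finset.mem_filter, Finset.mem_univ, true_and] at hx hz
    have := readPacket_eq (A := {p : Fin m × V × Fin (2 * γ - 1) | ¬ H.graph.Adj (e v).2 p.2.1})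
      (fun p => W p.1 p.2) (p := (f (e.symm ((e u).1, x)), (z, lab s x w')))
      (by simp [hv2, hpart x z hx.2 hz])
    exact congrFun this b
  rw [hT, hT] at hmsg
  have hmem : (e u).2 ∈ ({x : V | x ∈ (H.matching s).verts ∧ x ≠ w'} : Finset V) := by
    simp [hw, hne'.symm]
  rw [← Finset.add_sum_erase _ _ hmem, ← Finset.add_sum_erase _ _ hmem] at hmsg
  have hrest : ∑ x ∈ ({x : V | x ∈ (H.matching s).verts ∧ x ≠ w'} : Finset V).erase (e u).2, T W x
      = ∑ x ∈ ({x : V | x ∈ (H.matching s).verts ∧ x ≠ w'} : Finset V).erase (e u).2, T W' x := by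
    refine Finset.sum_congr rfl fun x hx => Finset.sum_congr rfl fun z hz => ?_
    simp only [Finset.mem_erase, Finset.mem_filter, Finset.mem_univ, true_and] at hx hz
    rw [hcache _ _ _ (hpart' x z hx.1 hz)]
  rw [hrest, add_left_inj] at hmsg
  have hsing : ({z : V | (H.matching s).Adj (e u).2 z} : Finset V) = {y} := by
    ext z
    simp only [Finset.mem_filter, Finset.mem_univ, true_and, Finset.mem_singleton]
    exact ⟨fun h => (H.isMatching s).eq_of_adj_left h hs, fun h => h ▸ hs⟩
  simpa [T, hsing, hj] using hmsg

/-- There are decoders which never fail. -/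
theorem rsScheme_exists_decoder (e : U ≃ ι × V) (H : RSGraph V γ τ)
    {lab : Fin τ → V → V → Fin (2 * γ - 1)} (hlab : IsLabelling H lab) :
    ∃ dec : (rsScheme e H lab m ℓ).Decoder, (rsScheme e H lab m ℓ).errorProb dec = 0 := by
  -- Any library consistent with the observations will do, since they determine the requested file.
  refine ⟨fun f u msgs cache =>
    if h : ∃ W : Library (V × Fin (2 * γ - 1)) m ℓ,
      (rsScheme e H lab m ℓ).cacheContent W u = cache ∧
      (fun v : {v : U // v ∈ (rsScheme e H lab m ℓ).rx u} =>
        (rsScheme e H lab m ℓ).message W f v.1) = msgs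
    then h.choose (f u) else 0, ?_⟩
  have key : ∀ W f u, (rsScheme e H lab m ℓ).estimate (fun f u msgs cache =>
    if h : ∃ W : Library (V × Fin (2 * γ - 1)) m ℓ,
      (rsScheme e H lab m ℓ).cacheContent W u = cache ∧
      (fun v : {v : U // v ∈ (rsScheme e H lab m ℓ).rx u} =>
        (rsScheme e H lab m ℓ).message W f v.1) = msgs
    then h.choose (f u) else 0) W f u = W (f u) := by
    intro W f u
    have h : ∃ W' : Library (V × Fin (2 * γ - 1)) m ℓ,
      (rsScheme e H lab m ℓ).cacheContent W' u = (rsScheme e H lab m ℓ).cacheContent W u ∧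
      (fun v : {v : U // v ∈ (rsScheme e H lab m ℓ).rx u} =>
        (rsScheme e H lab m ℓ).message W' f v.1)
      = (fun v : {v : U // v ∈ (rsScheme e H lab m ℓ).rx u} =>
        (rsScheme e H lab m ℓ).message W f v.1) := ⟨W, rfl, rfl⟩
    refine (dif_pos h).trans ?_
    exact rsScheme_decodable e H hlab _ _ f u h.choose_spec.1
      fun v hv => congrFun h.choose_spec.2 ⟨v, hv⟩
  simp [Scheme.errorProb, key]

end Decoding

/-! ### Transmission policy and throughput in a network -/

section Delivery

variable {s c g κ m γ τ : ℕ} {r Δ C M T : ℝ}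

/-- Time division over the reuse sets and over the positions in the clusters. -/
theorem deliverableIn_of_numBits_le {P : Type} {ℓ : ℕ} (cl : Clustering s c g r) {col : Fin c → Fin κ}
    (hcol : IsReuse Δ cl col) (S : Scheme (Users s) P m ℓ)
    (hrx : ∀ u v, u ∈ S.rx v → u ≠ v ∧ (cl.toEquiv u).1 = (cl.toEquiv v).1)
    (f : Users s → Fin m) (len : Fin g → ℕ)
    (hlen : ∀ u, (S.numBits f u : ℝ) ≤ C * len (cl.toEquiv u).2) :
    DeliverableIn r Δ C S f (κ * ∑ i, len i) := by
  -- Channel uses are numbered by triples (reuse set, position in the cluster, repetition), so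
  -- simultaneous transmitters share reuse set and position, and distinct ones lie in different
  -- clusters.
  have hcard : Fintype.card (Σ p : Fin κ × Fin g, Fin (len p.2)) = κ * ∑ i, len i := by
    simp [Fintype.sum_prod_type]
  let E := Fintype.equivFinOfCardEq hcard
  let slot : Users s → Finset ℕ := fun u =>
    Finset.univ.image fun q : Fin (len (cl.toEquiv u).2) =>
      (E ⟨(col (cl.toEquiv u).1, (cl.toEquiv u).2), q⟩ : ℕ)
  have hslot : ∀ t u u', t ∈ slot u → t ∈ slot u' →
      col (cl.toEquiv u).1 = col (cl.toEquiv u').1 ∧ (cl.toEquiv u).2 = (cl.toEquiv u').2 := by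
    intro t u u' h h'
    simp only [slot, Finset.mem_image, Finset.mem_univ, true_and] at h h'
    obtain ⟨q, hq⟩ := h
    obtain ⟨q', hq'⟩ := h'
    have := E.injective (Fin.ext (hq.trans hq'.symm))
    have h2 := congrArg Sigma.fst this
    exact Prod.mk.inj h2
  have hdist : ∀ u v, (cl.toEquiv u).1 = (cl.toEquiv v).1 → dist (pos u) (pos v) ≤ r := by
    intro u v h
    have := cl.dist_le (cl.toEquiv u).1 (cl.toEquiv u).2 (cl.toEquiv v).2
    rw [Prod.mk.eta, Equiv.symm_apply_apply, h, Prod.mk.eta, Equiv.symm_apply_apply] at this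
    exact this
  have hfar : ∀ u v, (cl.toEquiv u).1 ≠ (cl.toEquiv v).1 →
      col (cl.toEquiv u).1 = col (cl.toEquiv v).1 → (1 + Δ) * r ≤ dist (pos u) (pos v) := by
    intro u v h h'
    simpa using hcol _ _ h h' (cl.toEquiv u).2 (cl.toEquiv v).2
  refine ⟨fun t => {a | a.1 ≠ a.2 ∧ (cl.toEquiv a.1).1 = (cl.toEquiv a.2).1 ∧ t ∈ slot a.1},
    ?_, slot, ?_⟩
  · intro t a ha
    simp only [Finset.mem_filter, Finset.mem_univ, true_and] at ha
    refine ⟨ha.1, hdist _ _ ha.2.1, fun b hb hne => ?_⟩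
    simp only [Finset.mem_filter, Finset.mem_univ, true_and] at hb
    obtain ⟨h1, h2⟩ := hslot t _ _ ha.2.2 hb.2.2
    have hk : (cl.toEquiv a.1).1 ≠ (cl.toEquiv b.1).1 := fun h =>
      hne (cl.toEquiv.injective (Prod.ext h h2)).symm
    rw [ha.2.1] at hk h1
    exact hfar _ _ hk h1
  · intro u
    refine ⟨?_, ?_, ?_⟩
    · intro t ht
      simp only [slot, Finset.mem_image, Finset.mem_univ, true_and] at ht
      obtain ⟨q, rfl⟩ := ht
      simp
    · have : (slot u).card = len (cl.toEquiv u).2 := by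
        rw [Finset.card_image_of_injective, Finset.card_univ, Fintype.card_fin]
        intro q q' h
        simpa using E.injective (Fin.ext h)
      rw [this]
      exact hlen u
    · intro t ht v hv
      simpa [ht] using hrx u v hv

theorem numBits_rsScheme {U ι V : Type} [Fintype U] [Fintype V] {ℓ : ℕ} (e : U ≃ ι × V)
    (H : RSGraph V γ τ) (lab : Fin τ → V → V → Fin (2 * γ - 1)) (f : U → Fin m) (u : U) :
    (rsScheme e H lab m ℓ).numBits f u
      = Nat.card {s : Fin τ // (e u).2 ∈ (H.matching s).verts} * ℓ := by
  simp only [Scheme.numBits, rsScheme, Nat.card_prod, Nat.card_fin]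

/-- A throughput below `rsThroughput` leaves room for rounding the transmission times. -/
theorem eventually_mul_le_of_lt_rsThroughput (hγ : 0 < γ) (hg : 0 < g) (hC : 0 < C)
    (hT : T < rsThroughput C κ g γ τ) :
    ∀ᶠ ℓ : ℕ in atTop, ∀ D : ℝ, 0 ≤ D → D ≤ κ * ((2 * γ * τ : ℕ) * ℓ / C + g) →
      D * T ≤ ((Fintype.card (Fin g × Fin (2 * γ - 1)) * ℓ : ℕ) : ℝ) := by
  rcases le_or_gt T 0 with h0 | h0
  · refine Eventually.of_forall fun ℓ D hD _ => ?_
    exact (mul_nonpos_of_nonneg_of_nonpos hD h0).trans (Nat.cast_nonneg _)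
  have hγ' : (1 : ℝ) ≤ γ := by exact_mod_cast hγ
  have hg' : (0 : ℝ) < g := by exact_mod_cast hg
  have hK : ((Fintype.card (Fin g × Fin (2 * γ - 1)) : ℕ) : ℝ) = g * (2 * γ - 1) := by
    rw [Fintype.card_prod, Fintype.card_fin, Fintype.card_fin, Nat.cast_mul,
      Nat.cast_sub (by omega)]
    push_cast; ring
  have hκ : (0 : ℝ) < κ := by
    rcases Nat.eq_zero_or_pos κ with h | h
    · simp [rsThroughput, h] at hT; linarith
    · exact_mod_cast h
  have hτ : (0 : ℝ) < τ := by
    rcases Nat.eq_zero_or_pos τ with h | h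
    · simp [rsThroughput, h] at hT; linarith
    · exact_mod_cast h
  -- The strict inequality for `T` leaves slack linear in `ℓ`, which eventually absorbs the rounding
  -- cost `κ * T * g`.
  have hgap : 0 < g * (2 * γ - 1) - κ * T * (2 * γ * τ) / C := by
    rw [rsThroughput, lt_div_iff₀ (by have : (0:ℝ) < 2 * γ - 1 := by linarith
                                      positivity)] at hT
    rw [sub_pos, div_lt_iff₀ hC]
    have h1 : (0 : ℝ) < 2 * γ - 1 := by linarith
    have h2 : T * ((τ : ℝ) / g * (2 * γ / (2 * γ - 1)) * κ) * (g * (2 * γ - 1))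
        = κ * T * (2 * γ * τ) := by
      field_simp
    rw [← h2]
    calc _ < C * (g * (2 * γ - 1)) := by gcongr
      _ = _ := by ring
  have hlim : Tendsto (fun ℓ : ℕ => (g * (2 * γ - 1) - κ * T * (2 * γ * τ) / C) * (ℓ : ℝ))
      atTop atTop := tendsto_natCast_atTop_atTop.const_mul_atTop hgap
  filter_upwards [hlim.eventually_ge_atTop (κ * T * g)] with ℓ hℓ D _ hD
  rw [Nat.cast_mul, hK]
  calc D * T ≤ (κ * ((2 * γ * τ : ℕ) * ℓ / C + g)) * T := by gcongr
    _ = κ * T * (2 * γ * τ) / C * ℓ + κ * T * g := by push_cast; ring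
    _ ≤ g * (2 * γ - 1) * ℓ := by linarith

/-- The clustered RS scheme achieves its throughput in every network. -/
theorem throughputAchievable_rs (cl : Clustering s c g r) {col : Fin c → Fin κ}
    (hcol : IsReuse Δ cl col) (H : RSGraph (Fin g) γ τ) (hγ : 0 < γ) (hg : 0 < g) (hC : 0 < C)
    (hM : ∀ v, (m * Nat.card {w // ¬ H.graph.Adj v w} : ℝ) ≤ M * g)
    (hT : T < rsThroughput C κ g γ τ) :
    ThroughputAchievable s r Δ C (Fin g × Fin (2 * γ - 1)) m (IsClusteredRS cl H m) M T := by
  intro ε hε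
  obtain ⟨lab, hlab⟩ := H.exists_isLabelling hγ
  choose dec hdec using fun ℓ : ℕ => rsScheme_exists_decoder (m := m) (ℓ := ℓ) cl.toEquiv H hlab
  have hcardK : 0 < Fintype.card (Fin g × Fin (2 * γ - 1)) := by
    rw [Fintype.card_prod, Fintype.card_fin, Fintype.card_fin]
    exact Nat.mul_pos hg (by omega)
  let d : Fin g → ℕ := fun w => Nat.card {s : Fin τ // w ∈ (H.matching s).verts}
  refine ⟨id, fun ℓ => rsScheme cl.toEquiv H lab m ℓ, dec,
    ∑ u : Users s, (d (cl.toEquiv u).2 : ℝ), ?_, ?_, ?_, ?_, ?_, ?_⟩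
  · exact fun ℓ => ⟨lab, hlab, rfl⟩
  · exact Tendsto.const_mul_atTop' hcardK tendsto_id
  · intro ℓ u
    have h1 : ((rsScheme cl.toEquiv H lab m ℓ).cached u).card
        = m * Nat.card {w // ¬ H.graph.Adj (cl.toEquiv u).2 w} * (2 * γ - 1) := by
      have : (rsScheme cl.toEquiv H lab m ℓ).cached u
          = Finset.univ ×ˢ (Finset.univ.filter (fun w => ¬ H.graph.Adj (cl.toEquiv u).2 w) ×ˢ
            Finset.univ) := by
        ext ⟨i, w, j⟩
        simp [rsScheme]
      rw [this, Finset.card_product, Finset.card_product, Nat.card_eq_fintype_card,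
        Fintype.card_subtype]
      simp [mul_assoc]
    rw [h1, Fintype.card_prod, Fintype.card_fin, Fintype.card_fin]
    push_cast
    rw [← mul_assoc]
    exact mul_le_mul_of_nonneg_right (hM _) (Nat.cast_nonneg _)
  · refine Eventually.of_forall fun ℓ => ?_
    exact (hdec ℓ).trans_le hε.le
  · refine Eventually.of_forall fun ℓ f => ?_
    simp only [numBits_rsScheme, id, Nat.cast_mul, d]
    rw [Finset.sum_mul]
    refine Finset.sum_le_sum fun u _ => ?_
    have : (1 : ℝ) ≤ Fintype.card (Fin g × Fin (2 * γ - 1)) := by exact_mod_cast hcardK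
    gcongr
    exact le_mul_of_one_le_left (Nat.cast_nonneg _) this
  · filter_upwards [eventually_mul_le_of_lt_rsThroughput hγ hg hC hT] with ℓ hℓ f
    refine ⟨_, deliverableIn_of_numBits_le cl hcol _ ?_ f (fun i => ⌈(d i * ℓ : ℝ) / C⌉₊) ?_,
      hℓ _ (Nat.cast_nonneg _) ?_⟩
    · intro u v h
      simpa [rsScheme] using h
    · intro u
      refine (congrArg Nat.cast (numBits_rsScheme cl.toEquiv H lab f u)).trans_le ?_
      rw [mul_comm C, ← div_le_iff₀ hC]
      push_cast
      exact Nat.le_ceil _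
    · rw [Nat.cast_mul]
      gcongr
      rw [← H.sum_card_matchings]
      push_cast
      -- Rounding up wastes at most one channel use per position, hence the extra `g`.
      calc ∑ i, (⌈(d i * ℓ : ℝ) / C⌉₊ : ℝ) ≤ ∑ i, ((d i * ℓ : ℝ) / C + 1) := by
            refine Finset.sum_le_sum fun i _ => (Nat.ceil_lt_add_one ?_).le
            positivity
        _ = _ := by
          rw [Finset.sum_add_distrib, ← Finset.sum_div, ← Finset.sum_mul]
          simp [d]

end Delivery

/-! ### A core in which every vertex sees mostly populous classes -/

section Core

variable {X S : Type}

/-- The pairs of class `s` inside the vertex set `Y`. -/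
noncomputable def classPairs (E : Finset (X × X)) (cls : X × X → S) (Y : Finset X) (s : S) :
    Finset (X × X) :=
  {e ∈ E | e.1 ∈ Y ∧ e.2 ∈ Y ∧ cls e = s}

theorem card_classPairs_le_erase [DecidableEq X] {E : Finset (X × X)} {cls : X × X → S}
    (hE : ∀ x y, (x, y) ∈ E → (y, x) ∈ E ∧ cls (y, x) = cls (x, y)) (Y : Finset X) (v : X) (s : S) :
    (classPairs E cls Y s).card ≤ (classPairs E cls (Y.erase v) s).card
      + 2 * (Y.filter fun y => (v, y) ∈ E ∧ cls (v, y) = s).card := by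
  have hsub : classPairs E cls Y s ⊆ classPairs E cls (Y.erase v) s ∪
      ((Y.filter fun y => (v, y) ∈ E ∧ cls (v, y) = s).image (fun y => (v, y)) ∪
       (Y.filter fun y => (v, y) ∈ E ∧ cls (v, y) = s).image (fun y => (y, v))) := by
    rintro ⟨x, y⟩ h
    simp only [classPairs, Finset.mem_filter, Finset.mem_union, Finset.mem_erase,
      Finset.mem_image, Prod.mk.injEq] at h ⊢
    obtain ⟨h1, h2, h3, h4⟩ := h
    by_cases hx : x = v
    · subst hx
      exact Or.inr (Or.inl ⟨y, ⟨h3, h1, h4⟩, rfl, rfl⟩)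
    by_cases hy : y = v
    · subst hy
      exact Or.inr (Or.inr ⟨x, ⟨h2, (hE _ _ h1).1, (hE _ _ h1).2.trans h4⟩, rfl, rfl⟩)
    · exact Or.inl ⟨h1, ⟨hx, h2⟩, ⟨hy, h3⟩, h4⟩
  refine (Finset.card_le_card hsub).trans ((Finset.card_union_le _ _).trans ?_)
  refine Nat.add_le_add_left ((Finset.card_union_le _ _).trans ?_) _
  rw [two_mul]
  exact Nat.add_le_add Finset.card_image_le Finset.card_image_le

theorem sum_card_classPairs_le [Fintype S] (E : Finset (X × X)) (cls : X × X → S) (Y : Finset X) :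
    ∑ s, (classPairs E cls Y s).card ≤ Y.card ^ 2 := by
  have h := Finset.card_eq_sum_card_fiberwise (f := cls)
    (s := {e ∈ E | e.1 ∈ Y ∧ e.2 ∈ Y}) (t := Finset.univ) (fun _ _ => by simp)
  have h2 : ∀ s, classPairs E cls Y s = {e ∈ {e ∈ E | e.1 ∈ Y ∧ e.2 ∈ Y} | cls e = s} := by
    intro s
    ext e
    simp [classPairs, and_assoc]
  simp only [h2]
  rw [← h, sq, ← Finset.card_product]
  refine Finset.card_le_card fun e he => ?_
  simp only [Finset.mem_filter, Finset.mem_product] at he ⊢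
  exact he.2

/-- A large vertex set in which every vertex is paired, within populous classes, with almost all
the others. -/
theorem exists_core [Fintype X] [DecidableEq X] [Fintype S] (E : Finset (X × X)) (cls : X × X → S)
    (hE : ∀ x y, (x, y) ∈ E → (y, x) ∈ E ∧ cls (y, x) = cls (x, y)) (thr θ : ℕ) :
    ∃ Y : Finset X,
      (θ : ℤ) * (Fintype.card X - Y.card)
        ≤ (Fintype.card X : ℤ) ^ 2 - E.card + Fintype.card S * thr ∧
      ∀ v ∈ Y, 2 * (Y.filter fun y =>
        ¬ ((v, y) ∈ E ∧ thr < (classPairs E cls Y (cls (v, y))).card)).card ≤ θ + 1 := by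
  -- The potential counts pairs in `Y` not covered by the excess of the classes over `thr`, plus a
  -- penalty `θ` per deleted vertex. Comparing a minimiser with the whole set bounds the deletions;
  -- comparing it with `Y.erase v` bounds the bad partners of `v`.
  let F : Finset X → ℤ := fun Y => (Y.card : ℤ) ^ 2
    - ∑ s, (((classPairs E cls Y s).card - thr : ℕ) : ℤ) + θ * (Fintype.card X - Y.card)
  obtain ⟨Y, -, hY⟩ := Finset.exists_min_image (Finset.univ : Finset (Finset X)) F ⟨∅, by simp⟩
  refine ⟨Y, ?_, ?_⟩
  · have h1 := hY Finset.univ (Finset.mem_univ _)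
    simp only [F, Finset.card_univ, sub_self, mul_zero, add_zero] at h1
    have h2 : ∑ s, (((classPairs E cls Y s).card - thr : ℕ) : ℤ) ≤ (Y.card : ℤ) ^ 2 := by
      have h := sum_card_classPairs_le E cls Y
      calc ∑ s, (((classPairs E cls Y s).card - thr : ℕ) : ℤ)
          ≤ ∑ s, ((classPairs E cls Y s).card : ℤ) := by
            refine Finset.sum_le_sum fun s _ => ?_
            exact_mod_cast Nat.sub_le _ _
        _ ≤ _ := by exact_mod_cast h
    have h3 : (E.card : ℤ) - Fintype.card S * thr
        ≤ ∑ s, (((classPairs E cls Finset.univ s).card - thr : ℕ) : ℤ) := by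
      have h := Finset.card_eq_sum_card_fiberwise (f := cls)
        (s := E) (t := Finset.univ) (fun _ _ => by simp)
      have h4 : ∀ s, classPairs E cls Finset.univ s = {e ∈ E | cls e = s} := by
        intro s
        ext e
        simp [classPairs]
      simp only [h4]
      rw [h, Nat.cast_sum, ← nsmul_eq_mul, ← Finset.card_univ, ← Finset.sum_const,
        ← Finset.sum_sub_distrib]
      refine Finset.sum_le_sum fun s _ => ?_
      omega
    linarith
  · intro v hv
    have h1 := hY (Y.erase v) (Finset.mem_univ _)
    have hcard : (Y.erase v).card + 1 = Y.card := Finset.card_erase_add_one hv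
    let P : S → Prop := fun s => thr < (classPairs E cls Y s).card
    -- Classes at or below the threshold contribute zero, so deleting `v` costs only its pairs in
    -- populous classes, each counted in both orders.
    have h2 : ∑ s, (((classPairs E cls Y s).card - thr : ℕ) : ℤ)
        ≤ ∑ s, (((classPairs E cls (Y.erase v) s).card - thr : ℕ) : ℤ)
          + 2 * ((Y.filter fun y => (v, y) ∈ E ∧ P (cls (v, y))).card : ℤ) := by
      have h := Finset.card_eq_sum_card_fiberwise (f := fun y => cls (v, y))
        (s := Y.filter fun y => (v, y) ∈ E ∧ P (cls (v, y))) (t := Finset.univ)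
        (fun _ _ => by simp)
      rw [h, Nat.cast_sum, Finset.mul_sum, ← Finset.sum_add_distrib]
      refine Finset.sum_le_sum fun s _ => ?_
      have hle := card_classPairs_le_erase hE Y v s
      by_cases hs : P s
      · have : (Y.filter fun y => (v, y) ∈ E ∧ cls (v, y) = s)
            = (Y.filter fun y => (v, y) ∈ E ∧ P (cls (v, y))).filter
              fun y => cls (v, y) = s := by
          ext y
          simp only [Finset.mem_filter]
          constructor
          · rintro ⟨h1, h2, rfl⟩
            exact ⟨⟨h1, h2, hs⟩, rfl⟩
          · rintro ⟨⟨h1, h2, h3⟩, h4⟩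
            exact ⟨h1, h2, h4⟩
        rw [this] at hle
        omega
      · have : (classPairs E cls Y s).card - thr = 0 := by
          simp only [P] at hs
          omega
        rw [this]
        positivity
    have h3 := Finset.card_filter_add_card_filter_not (s := Y)
      (fun y => (v, y) ∈ E ∧ P (cls (v, y)))
    simp only [F] at h1
    have hc : ((Y.erase v).card : ℤ) = Y.card - 1 := by
      rw [← hcard]; push_cast; ring
    rw [hc] at h1
    have h5 : 2 * ((Y.filter fun y => ¬ ((v, y) ∈ E ∧ P (cls (v, y)))).card : ℤ) ≤ θ + 1 := by
      rw [← h3] at h1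
      push_cast at h1
      nlinarith
    exact_mod_cast h5

end Core

/-! ### A reserve spread evenly over the vertices -/

section LowLoad

variable {E V S : Type} [Fintype V] [DecidableEq V] [DecidableEq S]

/-- Among the choices of `r` elements from each class, one for which no vertex is contained in too
many of the chosen elements. -/
theorem exists_subset_load_le (𝓔 : Finset E) (cls : E → S) (A : Finset S) (inc : E → Finset V)
    (r r' k : ℕ) (hA : ∀ e ∈ 𝓔, cls e ∈ A) (hinc : ∀ e, (inc e).card ≤ 2)
    (hk : ∀ s v, (𝓔.filter fun e => cls e = s ∧ v ∈ inc e).card ≤ k)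
    (hr : ∀ s ∈ A, r + r' ≤ (𝓔.filter fun e => cls e = s).card) :
    ∃ R ⊆ 𝓔, (∀ s ∈ A, (R.filter fun e => cls e = s).card = r) ∧
      ∀ v, r' * ((R.filter fun e => v ∈ inc e).card - 2) ≤ 2 * k * (r * A.card) := by
  let load : Finset E → V → ℕ := fun R v => (R.filter fun e => v ∈ inc e).card
  have hsum : ∀ R, ∑ v, load R v ≤ 2 * R.card := by
    intro R
    have : ∑ v, load R v = ∑ e ∈ R, (inc e).card := by
      simp only [load, Finset.card_filter]
      rw [Finset.sum_comm]
      simp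
    rw [this, mul_comm, ← smul_eq_mul, ← Finset.sum_const]
    exact Finset.sum_le_sum fun e _ => hinc e
  have hne : ((𝓔.powerset).filter fun R => ∀ s ∈ A, (R.filter fun e => cls e = s).card = r).Nonempty := by
    have : ∀ s, ∃ R ⊆ 𝓔.filter (fun e => cls e = s), s ∈ A → R.card = r := by
      intro s
      by_cases hs : s ∈ A
      · obtain ⟨R, hR, hc⟩ := Finset.exists_subset_card_eq
          (show r ≤ (𝓔.filter fun e => cls e = s).card from (Nat.le_add_right _ _).trans (hr s hs))
        exact ⟨R, hR, fun _ => hc⟩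
      · exact ⟨∅, by simp, fun h => absurd h hs⟩
    choose R hR hRc using this
    refine ⟨A.biUnion R, ?_⟩
    rw [Finset.mem_filter, Finset.mem_powerset]
    refine ⟨Finset.biUnion_subset.2 fun s _ => (hR s).trans (Finset.filter_subset _ _), ?_⟩
    intro s hs
    rw [← hRc s hs]
    congr 1
    ext e
    simp only [Finset.mem_filter, Finset.mem_biUnion]
    constructor
    · rintro ⟨⟨a, _, ha⟩, rfl⟩
      have := (Finset.mem_filter.1 (hR a ha)).2
      rwa [this]
    · exact fun h => ⟨⟨s, hs, h⟩, (Finset.mem_filter.1 (hR s h)).2⟩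
  -- Minimising the sum of squared loads flattens the load: no exchange of two elements within a
  -- class can improve it.
  obtain ⟨R, hR, hmin⟩ := Finset.exists_min_image _ (fun R => ∑ v, (load R v : ℤ) ^ 2) hne
  rw [Finset.mem_filter, Finset.mem_powerset] at hR
  obtain ⟨hR𝓔, hRc⟩ := hR
  refine ⟨R, hR𝓔, hRc, fun v => ?_⟩
  have hswap : ∀ e ∈ R, ∀ f ∈ 𝓔, f ∉ R → cls e = cls f →
      ∑ v ∈ inc e, load R v ≤ ∑ v ∈ inc f, load R v + 2 := by
    intro e he f hf hfR hef
    have hfe : f ≠ e := fun h => hfR (h ▸ he)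
    have hmem : insert f (R.erase e) ∈
        (𝓔.powerset).filter fun R => ∀ s ∈ A, (R.filter fun e => cls e = s).card = r := by
      rw [Finset.mem_filter, Finset.mem_powerset]
      refine ⟨Finset.insert_subset hf ((Finset.erase_subset _ _).trans hR𝓔), fun s hs => ?_⟩
      rw [← hRc s hs, Finset.filter_insert]
      split_ifs with h
      · rw [Finset.card_insert_of_notMem (by simp [hfR]), Finset.filter_erase,
          Finset.card_erase_add_one (by simp [he, hef, h])]
      · rw [Finset.filter_erase, Finset.erase_eq_of_notMem (by simp [hef, h])]
    have hm := hmin _ hmem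
    have hload : ∀ v, (load (insert f (R.erase e)) v : ℤ)
        = load R v - (if v ∈ inc e then 1 else 0) + (if v ∈ inc f then 1 else 0) := by
      intro v
      have h1 : (load (R.erase e) v : ℤ) = load R v - (if v ∈ inc e then 1 else 0) := by
        simp only [load, Finset.filter_erase]
        split_ifs with h
        · rw [Finset.card_erase_of_mem (by simp [he, h]), Nat.cast_sub, Nat.cast_one]
          exact Finset.card_pos.2 ⟨e, by simp [he, h]⟩
        · rw [Finset.erase_eq_of_notMem (by simp [h]), sub_zero]
      rw [← h1]
      simp only [load, Finset.filter_insert]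
      split_ifs with h
      · rw [Finset.card_insert_of_notMem (by simp [hfR]), Nat.cast_add, Nat.cast_one]
      · rw [add_zero]
    -- The square is expanded and the cross term, which is nonpositive, is dropped. The two squared
    -- indicators sum to at most `2 + 2`; after halving they give the `+ 2` of the exchange
    -- inequality.
    have h2 : ∑ v, (load (insert f (R.erase e)) v : ℤ) ^ 2 ≤ ∑ v, ((load R v : ℤ) ^ 2
        - (if v ∈ inc e then 2 * (load R v : ℤ) else 0) + (if v ∈ inc f then 2 * (load R v : ℤ) else 0)
        + (if v ∈ inc e then 1 else 0) + (if v ∈ inc f then 1 else 0)) := by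
      refine Finset.sum_le_sum fun v _ => ?_
      rw [hload]
      split_ifs <;> nlinarith
    have h3 := hm.trans h2
    simp only [Finset.sum_add_distrib, Finset.sum_sub_distrib, Finset.sum_ite_mem,
      Finset.univ_inter, ← Finset.mul_sum, Finset.sum_const, nsmul_eq_mul, mul_one] at h3
    have h4 := hinc e
    have h5 := hinc f
    have h6 : ((∑ v ∈ inc e, load R v : ℕ) : ℤ) ≤ ((∑ v ∈ inc f, load R v : ℕ) : ℤ) + 2 := by
      push_cast
      omega
    exact_mod_cast h6
  rcases (R.filter fun e => v ∈ inc e).eq_empty_or_nonempty with h0 | ⟨e, he⟩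
  · simp [h0]
  obtain ⟨heR, hev⟩ := Finset.mem_filter.1 he
  have hs := hA e (hR𝓔 heR)
  set s := cls e with hs'
  have hv : load R v ≤ ∑ v ∈ inc e, load R v :=
    Finset.single_le_sum (f := load R) (fun _ _ => Nat.zero_le _) hev
  have hcardT : r' ≤ ((𝓔 \ R).filter fun e => cls e = s).card := by
    have h1 : ((𝓔 \ R).filter fun e => cls e = s)
        = (𝓔.filter fun e => cls e = s) \ (R.filter fun e => cls e = s) := by
      ext f
      simp only [Finset.mem_filter, Finset.mem_sdiff]
      tauto
    have h2 := Finset.le_card_sdiff (R.filter fun e => cls e = s) (𝓔.filter fun e => cls e = s)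
    rw [h1]
    have := hr s hs
    have := hRc s hs
    omega
  have hRtot : R.card = r * A.card := by
    rw [Finset.card_eq_sum_card_fiberwise (f := cls) (t := A) (fun e he => hA e (hR𝓔 he)),
      Finset.sum_congr rfl hRc]
    simp [mul_comm]
  -- If `e` in `R` meets `v`, each of the at least `r'` unchosen elements of its class has total
  -- load at least `load R v - 2`; these loads are then counted from the vertices.
  calc r' * (load R v - 2)
      ≤ ((𝓔 \ R).filter fun e => cls e = s).card * (load R v - 2) := Nat.mul_le_mul_right _ hcardT
    _ ≤ ∑ f ∈ (𝓔 \ R).filter fun e => cls e = s, ∑ v ∈ inc f, load R v := by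
        rw [← smul_eq_mul, ← Finset.sum_const]
        refine Finset.sum_le_sum fun f hf => ?_
        simp only [Finset.mem_filter, Finset.mem_sdiff] at hf
        have := hswap e heR f hf.1.1 hf.1.2 hf.2.symm
        omega
    _ ≤ ∑ f ∈ 𝓔.filter fun e => cls e = s, ∑ v ∈ inc f, load R v :=
        Finset.sum_le_sum_of_subset (Finset.filter_subset_filter _ Finset.sdiff_subset)
    _ = ∑ u, (𝓔.filter fun e => cls e = s ∧ u ∈ inc e).card * load R u := by
        have : ∀ f, ∑ v ∈ inc f, load R v = ∑ v, if v ∈ inc f then load R v else 0 := by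
          intro f
          simp
        simp only [this]
        rw [Finset.sum_comm]
        refine Finset.sum_congr rfl fun u _ => ?_
        rw [← Finset.sum_filter, Finset.sum_const, Finset.filter_filter, smul_eq_mul]
    _ ≤ ∑ u, k * load R u := Finset.sum_le_sum fun u _ => Nat.mul_le_mul_right _ (hk s u)
    _ ≤ k * (2 * R.card) := by
        rw [← Finset.mul_sum]
        exact Nat.mul_le_mul_left _ (hsum R)
    _ = 2 * k * (r * A.card) := by rw [hRtot]; ring

end LowLoad

/-! ### Partition into conflict-free blocks of equal size -/

section Blocks

variable {E : Type} {conf : E → E → Prop}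

/-- A set without conflicts can be extended within `T` up to size `γ`, or until every element of `T`
conflicts with it. -/
theorem exists_extend_pairwise (hrefl : ∀ e, conf e e) (hsymm : ∀ e f, conf e f → conf f e)
    {γ : ℕ} {I T : Finset E} (hIT : I ⊆ T) (hI : (I : Set E).Pairwise fun e f => ¬ conf e f)
    (hIc : I.card ≤ γ) :
    ∃ J, I ⊆ J ∧ J ⊆ T ∧ ((J : Set E).Pairwise fun e f => ¬ conf e f) ∧ J.card ≤ γ ∧
      (J.card < γ → ∀ t ∈ T, ∃ j ∈ J, conf t j) := by
  obtain ⟨J, hJ, hmax⟩ := Finset.exists_max_image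
    (T.powerset.filter fun J => I ⊆ J ∧ ((J : Set E).Pairwise fun e f => ¬ conf e f) ∧ J.card ≤ γ)
    Finset.card ⟨I, by simp [hIT, hI, hIc]⟩
  simp only [Finset.mem_filter, Finset.mem_powerset] at hJ hmax
  obtain ⟨hJT, hIJ, hJp, hJc⟩ := hJ
  refine ⟨J, hIJ, hJT, hJp, hJc, fun hlt t ht => ?_⟩
  by_contra! hno
  have htJ : t ∉ J := fun h => hno t h (hrefl t)
  have := hmax (insert t J) ⟨Finset.insert_subset ht hJT, hIJ.trans (Finset.subset_insert _ _), by
    rw [Finset.coe_insert, Set.pairwise_insert]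
    exact ⟨hJp, fun b hb _ => ⟨hno b hb, fun h => hno b hb (hsymm _ _ h)⟩⟩, by
    rw [Finset.card_insert_of_notMem htJ]; omega⟩
  rw [Finset.card_insert_of_notMem htJ] at this
  omega

/-- A set with bounded conflict degree is covered by disjoint conflict-free blocks of size exactly
`γ`, if there is a large enough reservoir `R` of further elements. -/
theorem exists_blocks [DecidableEq E] (hrefl : ∀ e, conf e e) (hsymm : ∀ e f, conf e f → conf f e)
    {M : Finset E} {D γ : ℕ} (hγ : 0 < γ) (hdeg : ∀ e ∈ M, (M.filter (conf e)).card ≤ D)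
    (d : ℕ) (O R : Finset E) (hO : O ⊆ M) (hR : R ⊆ M) (hOR : Disjoint O R)
    (hd : ∀ e ∈ O, (O.filter (conf e)).card ≤ d) (hc : (d + D) * γ ≤ R.card) :
    ∃ 𝓑 : Finset (Finset E),
      (∀ B ∈ 𝓑, B ⊆ O ∪ R ∧ B.card = γ ∧ (B : Set E).Pairwise fun e f => ¬ conf e f) ∧
      (∀ B ∈ 𝓑, ∀ B' ∈ 𝓑, B ≠ B' → Disjoint B B') ∧ ∀ e ∈ O, ∃ B ∈ 𝓑, e ∈ B := by
  induction hn : O.card using Nat.strong_induction_on generalizing O R d with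
  | _ n ih =>
  rcases O.eq_empty_or_nonempty with rfl | ⟨o, ho⟩
  · exact ⟨∅, by simp⟩
  obtain ⟨I, -, hI_sub, hIp, hIc, hImax⟩ := exists_extend_pairwise hrefl hsymm (γ := γ)
    (Finset.empty_subset O) (by simp) (by simp)
  have hIne : I.Nonempty := by
    rcases hIc.lt_or_eq with h | h
    · obtain ⟨j, hj, -⟩ := hImax h o ho
      exact ⟨j, hj⟩
    · exact Finset.card_pos.1 (h ▸ hγ)
  -- Elements conflict with themselves, so `d` is positive while `O` is nonempty. This makes the
  -- reservoir strictly larger than the conflicts of fewer than `γ` elements.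
  have hd1 : 1 ≤ d := (Finset.card_pos.2 ⟨o, by simp [ho, hrefl]⟩).trans_le (hd o ho)
  obtain ⟨J, hIJ, hJT, hJp, hJc, hJmax⟩ := exists_extend_pairwise hrefl hsymm (γ := γ)
    (Finset.subset_union_left (s₁ := I) (s₂ := R)) hIp hIc
  have hJγ : J.card = γ := by
    by_contra hne
    have hlt := lt_of_le_of_ne hJc hne
    have hJM : J ⊆ M := hJT.trans (Finset.union_subset (hI_sub.trans hO) hR)
    have hsub : R ⊆ J.biUnion fun j => M.filter (conf j) := by
      intro t ht
      obtain ⟨j, hj, htj⟩ := hJmax hlt t (Finset.mem_union_right _ ht)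
      exact Finset.mem_biUnion.2 ⟨j, hj, by simp [hR ht, hsymm _ _ htj]⟩
    have h1 : R.card ≤ J.card * D :=
      (Finset.card_le_card hsub).trans (Finset.card_biUnion_le_card_mul _ _ _
        fun j hj => hdeg j (hJM hj))
    have h2 : J.card * D ≤ γ * D := Nat.mul_le_mul_right _ hJc
    nlinarith
  have hcard : (O \ I).card < n := by
    rw [← hn]
    exact Finset.card_lt_card (Finset.sdiff_ssubset hI_sub hIne)
  have hsub1 : O \ I ⊆ O := Finset.sdiff_subset
  have key : ∃ 𝓑 : Finset (Finset E),
      (∀ B ∈ 𝓑, B ⊆ (O \ I) ∪ (R \ J) ∧ B.card = γ ∧ (B : Set E).Pairwise fun e f => ¬ conf e f) ∧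
      (∀ B ∈ 𝓑, ∀ B' ∈ 𝓑, B ≠ B' → Disjoint B B') ∧ ∀ e ∈ O \ I, ∃ B ∈ 𝓑, e ∈ B := by
    -- If `I` is short, it is maximal in `O`: every remaining element loses a conflict, and the drop
    -- of `d` by one pays for the at most `γ` reservoir elements used. If `I` is full, the reservoir
    -- is untouched.
    rcases hIc.lt_or_eq with h | h
    · refine ih _ hcard (d - 1) (O \ I) (R \ J) (hsub1.trans hO)
        (Finset.sdiff_subset.trans hR)
        (hOR.mono hsub1 Finset.sdiff_subset) ?_ ?_ rfl
      · intro e he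
        have heO := hsub1 he
        obtain ⟨i, hi, hei⟩ := hImax h e heO
        have : ((O \ I).filter (conf e)).card < (O.filter (conf e)).card := by
          refine Finset.card_lt_card ⟨Finset.filter_subset_filter _ hsub1, fun hs => ?_⟩
          have := hs (Finset.mem_filter.2 ⟨hI_sub hi, hei⟩)
          simp [hi] at this
        have := hd e heO
        omega
      · have h1 := Finset.le_card_sdiff J R
        obtain ⟨d, rfl⟩ : ∃ d', d = d' + 1 := ⟨d - 1, by omega⟩
        simp only [Nat.add_sub_cancel]
        have : (d + 1 + D) * γ = (d + D) * γ + γ := by ring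
        omega
    · have hIJ' : I = J := Finset.eq_of_subset_of_card_le hIJ (by omega)
      have hRJ : R \ J = R := by
        rw [← hIJ', Finset.sdiff_eq_self_iff_disjoint]
        exact (hOR.mono_left hI_sub).symm
      rw [hRJ]
      refine ih _ hcard d (O \ I) R (hsub1.trans hO) hR (hOR.mono_left hsub1) ?_ hc rfl
      exact fun e he => (Finset.card_le_card (Finset.filter_subset_filter _ hsub1)).trans
        (hd e (hsub1 he))
  obtain ⟨𝓑, h1, h2, h3⟩ := key
  have hdisj : ∀ B ∈ 𝓑, Disjoint J B := by
    intro B hB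
    refine Finset.disjoint_left.2 fun x hxJ hxB => ?_
    have hx := (h1 B hB).1 hxB
    have hxJ' := hJT hxJ
    simp only [Finset.mem_union, Finset.mem_sdiff] at hx hxJ'
    rcases hx with ⟨hxO, hxI⟩ | ⟨_, hx⟩
    · rcases hxJ' with h | h
      · exact hxI h
      · exact Finset.disjoint_left.1 hOR hxO h
    · exact hx hxJ
  refine ⟨insert J 𝓑, ?_, ?_, ?_⟩
  · intro B hB
    rcases Finset.mem_insert.1 hB with rfl | hB
    · exact ⟨hJT.trans (Finset.union_subset_union_left hI_sub), hJγ, hJp⟩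
    · exact ⟨(h1 B hB).1.trans (Finset.union_subset_union hsub1 Finset.sdiff_subset), (h1 B hB).2⟩
  · intro B hB B' hB' hne
    rcases Finset.mem_insert.1 hB with rfl | hm <;> rcases Finset.mem_insert.1 hB' with rfl | hm'
    · exact absurd rfl hne
    · exact hdisj _ hm'
    · exact (hdisj _ hm).symm
    · exact h2 _ hm _ hm' hne
  · intro e he
    by_cases heI : e ∈ I
    · exact ⟨J, Finset.mem_insert_self _ _, hIJ heI⟩
    · obtain ⟨B, hB, heB⟩ := h3 e (by simp [he, heI])
      exact ⟨B, Finset.mem_insert_of_mem hB, heB⟩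

/-- Disjoint sets of edges, each of them an induced matching in the ambient graph `G`, are the
matchings of a Ruzsa–Szemerédi graph. -/
theorem exists_rsGraph_of_blocks {V : Type} (G : SimpleGraph V) (𝓑 : Finset (Finset (Sym2 V)))
    {γ : ℕ} (hcard : ∀ B ∈ 𝓑, B.card = γ) (hG : ∀ B ∈ 𝓑, ∀ e ∈ B, e ∈ G.edgeSet)
    (hind : ∀ B ∈ 𝓑, ∀ e ∈ B, ∀ f ∈ B, e ≠ f → ∀ a ∈ e, ∀ b ∈ f, a ≠ b ∧ ¬ G.Adj a b)
    (hdisj : ∀ B ∈ 𝓑, ∀ B' ∈ 𝓑, B ≠ B' → Disjoint B B') :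
    ∃ H : RSGraph V γ 𝓑.card, ∀ x y, H.graph.Adj x y ↔ ∃ B ∈ 𝓑, s(x, y) ∈ B := by
  -- Only covered edges are kept. As `H` lies inside `G`, matchings induced in `G` stay induced.
  let H : SimpleGraph V :=
    { Adj := fun x y => ∃ B ∈ 𝓑, s(x, y) ∈ B
      symm := ⟨fun x y h => by simpa only [Sym2.eq_swap] using h⟩
      loopless := ⟨fun x ⟨B, hB, h⟩ => G.loopless.irrefl x (hG B hB _ h)⟩ }
  let e := 𝓑.equivFin.symm
  let M : Fin 𝓑.card → H.Subgraph := fun i =>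
    { verts := {v | ∃ f ∈ (e i).1, v ∈ f}
      Adj := fun x y => s(x, y) ∈ (e i).1
      adj_sub := fun h => ⟨_, (e i).2, h⟩
      edge_vert := fun h => ⟨_, h, Sym2.mem_mk_left _ _⟩
      symm := ⟨fun x y h => by rwa [Sym2.eq_swap]⟩ }
  have hedge : ∀ i, (M i).edgeSet = ((e i).1 : Set (Sym2 V)) := by
    intro i
    ext f
    induction f with | _ x y => rfl
  refine ⟨⟨H, M, ?_, ?_, ?_, ?_, ?_⟩, fun _ _ => Iff.rfl⟩
  · rintro i v ⟨f, hf, hv⟩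
    obtain ⟨w, rfl⟩ := hv
    refine ⟨w, hf, fun y hy => ?_⟩
    by_contra hne
    have hne' : s(v, y) ≠ s(v, w) := fun h => hne (Sym2.congr_right.1 h)
    exact (hind _ (e i).2 _ hy _ hf hne' v (Sym2.mem_mk_left _ _) v (Sym2.mem_mk_left _ _)).1 rfl
  · rintro i x ⟨f, hf, hx⟩ y ⟨f', hf', hy⟩ ⟨B, hB, hxy⟩
    change s(x, y) ∈ (e i).1
    have hadj : G.Adj x y := hG B hB _ hxy
    rcases eq_or_ne f f' with rfl | hne
    · rwa [← (Sym2.mem_and_mem_iff hadj.ne).1 ⟨hx, hy⟩]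
    · exact absurd hadj (hind _ (e i).2 f hf f' hf' hne x hx y hy).2
  · intro i
    rw [hedge, Set.ncard_coe_finset, hcard _ (e i).2]
  · intro i j hij
    rw [hedge, hedge, Finset.disjoint_coe]
    exact hdisj _ (e i).2 _ (e j).2 fun h => hij (e.injective (Subtype.ext h))
  · ext f
    induction f with | _ x y =>
    simp only [hedge, Set.mem_iUnion, Finset.mem_coe]
    constructor
    · rintro ⟨i, hi⟩
      exact ⟨_, (e i).2, hi⟩
    · rintro ⟨B, hB, h⟩
      exact ⟨e.symm ⟨B, hB⟩, by simpa using h⟩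

end Blocks

/-! ### The grid construction -/

section Geometry

variable {n Λ : ℕ}

/-- The squared Euclidean distance in the grid. -/
def sqDist (x y : Fin n → Fin Λ) : ℤ := ∑ i, ((x i : ℤ) - (y i : ℤ)) ^ 2

theorem sqDist_comm (x y : Fin n → Fin Λ) : sqDist x y = sqDist y x :=
  Finset.sum_congr rfl fun _ _ => by ring

@[simp] theorem sqDist_self (x : Fin n → Fin Λ) : sqDist x x = 0 := by simp [sqDist]

/-- The coordinatewise sum of a pair of grid points. -/
def pairSum (e : (Fin n → Fin Λ) × (Fin n → Fin Λ)) : Fin n → Fin (2 * Λ) :=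
  fun i => ⟨(e.1 i : ℕ) + (e.2 i : ℕ), by have := (e.1 i).2; have := (e.2 i).2; omega⟩

theorem pairSum_swap (x y : Fin n → Fin Λ) : pairSum (y, x) = pairSum (x, y) := by
  funext i
  simp [pairSum, add_comm]

theorem pairSum_eq_iff {x y x' y' : Fin n → Fin Λ} :
    pairSum (x, y) = pairSum (x', y') ↔ ∀ i, (x i : ℕ) + y i = x' i + y' i := by
  simp [pairSum, funext_iff]

theorem pairSum_right_injective (x : Fin n → Fin Λ) :
    Function.Injective fun y => pairSum (x, y) := by
  intro y y' h
  funext i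
  have := pairSum_eq_iff.1 h i
  exact Fin.ext (by omega)

/-- Equal sums mean a common midpoint, so this is the parallelogram law with the two pairs as
diagonals. -/
theorem sqDist_parallelogram {x y x' y' : Fin n → Fin Λ}
    (h : pairSum (x, y) = pairSum (x', y')) :
    sqDist x y + sqDist x' y' = 2 * (sqDist x x' + sqDist x y') := by
  simp only [sqDist, Finset.mul_sum, ← Finset.sum_add_distrib]
  refine Finset.sum_congr rfl fun i _ => ?_
  have h1 := pairSum_eq_iff.1 h i
  have h2 : (y' i : ℤ) = x i + y i - x' i := by omega
  rw [h2]
  ring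

theorem sum_half_pow_le (a L : ℕ) :
    ∑ b : Fin L, ((1 : ℝ) / 2) ^ ((a : ℤ) - (b : ℕ)).natAbs ≤ 4 := by
  rw [Fin.sum_univ_eq_sum_range (fun b => ((1 : ℝ) / 2) ^ ((a : ℤ) - (b : ℕ)).natAbs) L]
  have h1 : ∑ b ∈ Finset.range (a + 1), ((1 : ℝ) / 2) ^ ((a : ℤ) - (b : ℕ)).natAbs ≤ 2 := by
    rw [← Finset.sum_range_reflect]
    refine le_trans (le_of_eq ?_) (sum_geometric_two_le (a + 1))
    refine Finset.sum_congr rfl fun b hb => ?_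
    congr 1
    have := Finset.mem_range.1 hb
    omega
  have h2 : ∑ b ∈ Finset.Ico a L, ((1 : ℝ) / 2) ^ ((a : ℤ) - (b : ℕ)).natAbs ≤ 2 := by
    rw [Finset.sum_Ico_eq_sum_range]
    refine le_trans (le_of_eq ?_) (sum_geometric_two_le (L - a))
    refine Finset.sum_congr rfl fun b hb => ?_
    congr 1
    push_cast
    omega
  have hsub : Finset.range L ⊆ Finset.range (a + 1) ∪ Finset.Ico a L := by
    intro b hb
    simp only [Finset.mem_union, Finset.mem_range, Finset.mem_Ico] at hb ⊢
    omega
  calc _ ≤ ∑ b ∈ Finset.range (a + 1) ∪ Finset.Ico a L,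
        ((1 : ℝ) / 2) ^ ((a : ℤ) - (b : ℕ)).natAbs :=
        Finset.sum_le_sum_of_subset_of_nonneg hsub fun _ _ _ => by positivity
    _ ≤ ∑ b ∈ Finset.range (a + 1), ((1 : ℝ) / 2) ^ ((a : ℤ) - (b : ℕ)).natAbs
        + ∑ b ∈ Finset.Ico a L, ((1 : ℝ) / 2) ^ ((a : ℤ) - (b : ℕ)).natAbs := by
        rw [← Finset.sum_union_inter]
        exact le_add_of_nonneg_right (Finset.sum_nonneg fun _ _ => by positivity)
    _ ≤ 4 := by linarith

/-- The number of grid points in a ball of radius `√n`. -/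
theorem card_sqDist_le (x : Fin n → Fin Λ) :
    (Finset.univ.filter fun y => sqDist x y ≤ n).card ≤ 8 ^ n := by
  -- For integers `|a| ≤ a ^ 2`, so the ball lies in an `ℓ¹` ball of radius `n`, where this weight
  -- is at least `2 ^ (-n)`. The total weight is at most `4 ^ n`.
  let w : (Fin n → Fin Λ) → ℝ := fun y => ∏ i, ((1 : ℝ) / 2) ^ ((x i : ℤ) - (y i : ℕ)).natAbs
  have hw : ∀ y, sqDist x y ≤ n → (1 : ℝ) ≤ 2 ^ n * w y := by
    intro y hy
    have h1 : ∑ i, ((x i : ℤ) - (y i : ℕ)).natAbs ≤ n := by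
      have : ((∑ i, ((x i : ℤ) - (y i : ℕ)).natAbs : ℕ) : ℤ) ≤ sqDist x y := by
        rw [Nat.cast_sum]
        refine Finset.sum_le_sum fun i _ => ?_
        rw [← Int.natAbs_sq]
        exact_mod_cast Nat.le_self_pow two_ne_zero _
      omega
    simp only [w]
    rw [Finset.prod_pow_eq_pow_sum]
    calc (1 : ℝ) = 2 ^ n * (1 / 2) ^ n := by rw [← mul_pow]; norm_num
      _ ≤ _ := by
        gcongr ?_ * ?_
        exact pow_le_pow_of_le_one (by norm_num) (by norm_num) h1
  have hsum : ∑ y, w y ≤ 4 ^ n := by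
    have := Finset.prod_univ_sum (fun _ : Fin n => (Finset.univ : Finset (Fin Λ)))
      (fun i b => ((1 : ℝ) / 2) ^ ((x i : ℤ) - (b : ℕ)).natAbs)
    rw [Fintype.piFinset_univ] at this
    simp only [w]
    rw [← this]
    calc _ ≤ ∏ _i : Fin n, (4 : ℝ) :=
          Finset.prod_le_prod (fun _ _ => Finset.sum_nonneg fun _ _ => by positivity)
            fun i _ => sum_half_pow_le _ _
      _ = 4 ^ n := by simp
  have : ((Finset.univ.filter fun y => sqDist x y ≤ n).card : ℝ) ≤ 8 ^ n := by
    calc ((Finset.univ.filter fun y => sqDist x y ≤ n).card : ℝ)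
        = ∑ y ∈ Finset.univ.filter fun y => sqDist x y ≤ n, (1 : ℝ) := by simp
      _ ≤ ∑ y ∈ Finset.univ.filter fun y => sqDist x y ≤ n, 2 ^ n * w y :=
          Finset.sum_le_sum fun y hy => hw y (Finset.mem_filter.1 hy).2
      _ ≤ ∑ y, 2 ^ n * w y := Finset.sum_le_sum_of_subset_of_nonneg (Finset.filter_subset _ _)
          fun _ _ _ => mul_nonneg (by positivity) (Finset.prod_nonneg fun _ _ => by positivity)
      _ = 2 ^ n * ∑ y, w y := by rw [Finset.mul_sum]
      _ ≤ 2 ^ n * 4 ^ n := by gcongr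
      _ = 8 ^ n := by rw [← mul_pow]; norm_num
  exact_mod_cast this

/-- The pairs of distinct grid points at typical distance. -/
noncomputable def typicalPairs (n Λ : ℕ) (μ : ℝ) : Finset ((Fin n → Fin Λ) × (Fin n → Fin Λ)) :=
  Finset.univ.filter fun e => e.1 ≠ e.2 ∧ |(sqDist e.1 e.2 : ℝ) - μ| ≤ n / 2

theorem typicalPairs_symm {μ : ℝ} (x y : Fin n → Fin Λ) (h : (x, y) ∈ typicalPairs n Λ μ) :
    (y, x) ∈ typicalPairs n Λ μ ∧ pairSum (y, x) = pairSum (x, y) := by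
  refine ⟨?_, pairSum_swap x y⟩
  simp only [typicalPairs, Finset.mem_filter, Finset.mem_univ, true_and] at h ⊢
  rw [sqDist_comm]
  exact ⟨h.1.symm, h.2⟩

/-- If two typical pairs have the same sum, and also `(x, x')` is typical, then `x` and `y'` are
close. -/
theorem sqDist_le_of_typicalPairs {μ : ℝ} {x y x' y' : Fin n → Fin Λ}
    (h : pairSum (x, y) = pairSum (x', y')) (h1 : (x, y) ∈ typicalPairs n Λ μ)
    (h2 : (x', y') ∈ typicalPairs n Λ μ) (h3 : (x, x') ∈ typicalPairs n Λ μ) :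
    sqDist x y' ≤ n := by
  simp only [typicalPairs, Finset.mem_filter, Finset.mem_univ, true_and, abs_le] at h1 h2 h3
  have hp : (sqDist x y : ℝ) + sqDist x' y' = 2 * (sqDist x x' + sqDist x y') := by
    exact_mod_cast sqDist_parallelogram h
  -- Half the sum of the diagonals is at most `μ + n / 2` and the typical side at least `μ - n / 2`.
  have : (sqDist x y' : ℝ) ≤ n := by linarith [h1.2.2, h2.2.2, h3.2.1]
  exact_mod_cast this

section Pullback

variable {V : Type} (π : V → Fin n → Fin Λ)

/-- The sum of the two ends of an edge. -/
def edgeSum : Sym2 V → Fin n → Fin (2 * Λ) :=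
  Sym2.lift ⟨fun u v => pairSum (π u, π v), fun u v => pairSum_swap (π v) (π u)⟩

/-- The pullback of the typical pairs along `π`. -/
def typicalGraph (μ : ℝ) : SimpleGraph V where
  Adj u v := (π u, π v) ∈ typicalPairs n Λ μ
  symm := ⟨fun u v h => (typicalPairs_symm _ _ h).1⟩
  loopless := ⟨fun u h => by simp [typicalPairs] at h⟩

/-- Two edges are close if they have ends whose images are close. -/
def CloseEdges (e f : Sym2 V) : Prop := ∃ a ∈ e, ∃ b ∈ f, sqDist (π a) (π b) ≤ n

variable {π}

theorem closeEdges_refl (e : Sym2 V) : CloseEdges π e e := by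
  induction e with | _ a b =>
  exact ⟨a, Sym2.mem_mk_left _ _, a, Sym2.mem_mk_left _ _, by simp⟩

theorem closeEdges_symm (e f : Sym2 V) (h : CloseEdges π e f) : CloseEdges π f e := by
  obtain ⟨a, ha, b, hb, hab⟩ := h
  exact ⟨b, hb, a, ha, by rwa [sqDist_comm]⟩

/-- An adjacency between ends of the two edges would be a typical side of the parallelogram and
force the neighbouring side to be short. -/
theorem not_adj_of_not_closeEdges {μ : ℝ} {e f : Sym2 V} (he : e ∈ (typicalGraph π μ).edgeSet)
    (hf : f ∈ (typicalGraph π μ).edgeSet) (hef : edgeSum π e = edgeSum π f)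
    (h : ¬ CloseEdges π e f) {a b : V} (ha : a ∈ e) (hb : b ∈ f) :
    a ≠ b ∧ ¬ (typicalGraph π μ).Adj a b := by
  constructor
  · rintro rfl
    exact h ⟨a, ha, a, hb, by simp⟩
  · intro hab
    obtain ⟨a', rfl⟩ := ha
    obtain ⟨b', rfl⟩ := hb
    exact h ⟨a, Sym2.mem_mk_left _ _, b', Sym2.mem_mk_right _ _,
      sqDist_le_of_typicalPairs hef he hf hab⟩

/-- One end and the sum determine the image of the other end, and fibres of `π` have at most two
points. -/
theorem card_edges_at_vertex_le [Fintype V] [DecidableEq V] (hπ : ∀ x, (Finset.univ.filter fun v => π v = x).card ≤ 2)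
    (𝓔 : Finset (Sym2 V)) (s : Fin n → Fin (2 * Λ)) (v : V) :
    (𝓔.filter fun e => edgeSum π e = s ∧ v ∈ e.toFinset).card ≤ 2 := by
  by_cases hs : ∃ x, pairSum (π v, x) = s
  · obtain ⟨x, hx⟩ := hs
    refine le_trans (Finset.card_le_card fun e he => ?_)
      ((Finset.card_image_le (f := fun w => s(v, w))).trans (hπ x))
    simp only [Finset.mem_filter, Sym2.mem_toFinset] at he
    obtain ⟨-, h1, w, rfl⟩ := he
    simp only [Finset.mem_image, Finset.mem_filter, Finset.mem_univ, true_and]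
    exact ⟨w, pairSum_right_injective (π v) (h1.trans hx.symm), rfl⟩
  · rw [Finset.card_eq_zero.2]
    · exact Nat.zero_le _
    · rw [Finset.eq_empty_iff_forall_notMem]
      intro e he
      simp only [Finset.mem_filter, Sym2.mem_toFinset] at he
      obtain ⟨-, h1, w, rfl⟩ := he
      exact hs ⟨_, h1⟩

/-- Two ends of `e`, at most `2 * 8 ^ n` vertices close to each, and at most two edges of the class
at each of those. -/
theorem card_closeEdges_le [Fintype V] [DecidableEq V] (hπ : ∀ x, (Finset.univ.filter fun v => π v = x).card ≤ 2)
    (𝓔 : Finset (Sym2 V)) (s : Fin n → Fin (2 * Λ)) (e : Sym2 V) :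
    ((𝓔.filter fun f => edgeSum π f = s).filter (CloseEdges π e)).card ≤ 8 * 8 ^ n := by
  have hball : ∀ u, (Finset.univ.filter fun a => sqDist (π u) (π a) ≤ n).card ≤ 2 * 8 ^ n := by
    intro u
    refine (Finset.card_le_mul_card_image (f := π) _ 2 fun x _ => ?_).trans
      (Nat.mul_le_mul_left 2 ((Finset.card_le_card ?_).trans (card_sqDist_le (π u))))
    · exact (Finset.card_le_card (Finset.filter_subset_filter _ (Finset.filter_subset _ _))).trans
        (hπ x)
    · intro x hx
      obtain ⟨a, ha, rfl⟩ := Finset.mem_image.1 hx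
      simpa using ha
  have hsub : ((𝓔.filter fun f => edgeSum π f = s).filter (CloseEdges π e)) ⊆
      e.toFinset.biUnion fun u =>
        (Finset.univ.filter fun a => sqDist (π u) (π a) ≤ n).biUnion fun a =>
          𝓔.filter fun f => edgeSum π f = s ∧ a ∈ f.toFinset := by
    intro f hf
    simp only [Finset.mem_filter] at hf
    obtain ⟨⟨h1, h2⟩, a, ha, b, hb, hab⟩ := hf
    simp only [Finset.mem_biUnion, Sym2.mem_toFinset, Finset.mem_filter, Finset.mem_univ, true_and]
    exact ⟨a, ha, b, hab, h1, h2, hb⟩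
  have he : e.toFinset.card ≤ 2 := by
    induction e with | _ a b =>
    rw [Sym2.toFinset_mk_eq]
    exact Finset.card_le_two
  calc _ ≤ _ := Finset.card_le_card hsub
    _ ≤ e.toFinset.card * (2 * 8 ^ n * 2) :=
      Finset.card_biUnion_le_card_mul _ _ _ fun u _ =>
        (Finset.card_biUnion_le_card_mul _ _ 2 fun a _ =>
          card_edges_at_vertex_le hπ _ _ _).trans (Nat.mul_le_mul_right _ (hball u))
    _ ≤ 2 * (2 * 8 ^ n * 2) := Nat.mul_le_mul_right _ he
    _ = _ := by ring

/-- A section of `π` over `Y` lifts the pairs to edges; the factor two comes from forgetting the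
order. -/
theorem card_classPairs_le_edges [Fintype V] {μ : ℝ} {Y : Finset (Fin n → Fin Λ)}
    (hY : ∀ y ∈ Y, ∃ v, π v = y) (s : Fin n → Fin (2 * Λ)) :
    (classPairs (typicalPairs n Λ μ) pairSum Y s).card
      ≤ 2 * ((typicalGraph π μ).edgeFinset.filter fun e => edgeSum π e = s).card := by
  rcases isEmpty_or_nonempty V with hV | hV
  · have : Y = ∅ := by
      rw [Finset.eq_empty_iff_forall_notMem]
      intro y hy
      obtain ⟨v, -⟩ := hY y hy
      exact hV.elim v
    simp [this, classPairs]
  have : ∃ σ : (Fin n → Fin Λ) → V, ∀ y ∈ Y, π (σ y) = y := by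
    choose! σ hσ using hY
    exact ⟨σ, hσ⟩
  obtain ⟨σ, hσ⟩ := this
  refine (Finset.card_le_mul_card_image (f := fun e => s(σ e.1, σ e.2)) _ 2 ?_).trans
    (Nat.mul_le_mul_left 2 (Finset.card_le_card ?_))
  · intro e he
    obtain ⟨⟨x, y⟩, -, rfl⟩ := Finset.mem_image.1 he
    refine (Finset.card_le_card (t := {(π (σ x), π (σ y)), (π (σ y), π (σ x))}) ?_).trans
      Finset.card_le_two
    rintro ⟨x', y'⟩ h
    simp only [classPairs, Finset.mem_filter, Sym2.eq_iff] at h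
    obtain ⟨⟨-, hx, hy, -⟩, h⟩ := h
    simp only [Finset.mem_insert, Finset.mem_singleton, Prod.mk.injEq]
    rcases h with ⟨h1, h2⟩ | ⟨h1, h2⟩
    · rw [← h1, ← h2, hσ _ hx, hσ _ hy]; simp
    · rw [← h1, ← h2, hσ _ hx, hσ _ hy]; simp
  · intro e he
    obtain ⟨⟨x, y⟩, h, rfl⟩ := Finset.mem_image.1 he
    simp only [classPairs, Finset.mem_filter] at h
    obtain ⟨h1, h2, h3, h4⟩ := h
    simp only [Finset.mem_filter, SimpleGraph.mem_edgeFinset, SimpleGraph.mem_edgeSet]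
    constructor
    · change (π (σ x), π (σ y)) ∈ _
      rwa [hσ _ h2, hσ _ h3]
    · change pairSum (π (σ x), π (σ y)) = s
      rwa [hσ _ h2, hσ _ h3]

end Pullback

/-- A surjection with fibres of at most two elements. -/
theorem exists_two_to_one {X : Type} [DecidableEq X] {Y : Finset X} {N : ℕ} (h1 : Y.card ≤ N)
    (h2 : N ≤ 2 * Y.card) :
    ∃ π : Fin N → X, (∀ v, π v ∈ Y) ∧ (∀ y ∈ Y, ∃ v, π v = y) ∧
      ∀ x, (Finset.univ.filter fun v => π v = x).card ≤ 2 := by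
  rcases Nat.eq_zero_or_pos Y.card with h0 | h0
  · obtain rfl : N = 0 := by omega
    refine ⟨Fin.elim0, fun v => v.elim0, fun y hy => ?_, fun x => by simp⟩
    rw [Finset.card_eq_zero] at h0
    simp [h0] at hy
  let q := Y.equivFin
  -- Reduction modulo `Y.card`: as `N ≤ 2 * Y.card`, the quotient is `0` or `1`, so each residue
  -- occurs at most twice.
  refine ⟨fun v => (q.symm ⟨v % Y.card, Nat.mod_lt _ h0⟩).1, fun v => (q.symm _).2, ?_, ?_⟩
  · intro y hy
    refine ⟨⟨q ⟨y, hy⟩, (q ⟨y, hy⟩).2.trans_le h1⟩, ?_⟩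
    have : (⟨(q ⟨y, hy⟩ : ℕ) % Y.card, Nat.mod_lt _ h0⟩ : Fin Y.card) = q ⟨y, hy⟩ :=
      Fin.ext (Nat.mod_eq_of_lt (q ⟨y, hy⟩).2)
    simp only [this, Equiv.symm_apply_apply]
  · intro x
    by_contra! hlt
    obtain ⟨a, b, c, ha, hb, hc, hab, hac, hbc⟩ := Finset.two_lt_card_iff.1 hlt
    simp only [Finset.mem_filter, Finset.mem_univ, true_and] at ha hb hc
    have hq : ∀ u v : Fin N, (q.symm ⟨u % Y.card, Nat.mod_lt _ h0⟩).1
        = (q.symm ⟨v % Y.card, Nat.mod_lt _ h0⟩).1 → (u : ℕ) % Y.card = v % Y.card := by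
      intro u v h
      have := q.symm.injective (Subtype.ext h)
      simpa using this
    have e1 := hq a b (ha.trans hb.symm)
    have e2 := hq a c (ha.trans hc.symm)
    have hlt2 : ∀ u : Fin N, (u : ℕ) / Y.card < 2 := fun u => by
      rw [Nat.div_lt_iff_lt_mul h0]
      exact u.2.trans_le h2
    have l1 := hlt2 a
    have l2 := hlt2 b
    have l3 := hlt2 c
    have hne : ∀ u v : Fin N, u ≠ v → (u : ℕ) % Y.card = v % Y.card →
        (u : ℕ) / Y.card ≠ v / Y.card := by
      intro u v huv hm hd
      refine huv (Fin.ext ?_)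
      rw [← Nat.div_add_mod (u : ℕ) Y.card, ← Nat.div_add_mod (v : ℕ) Y.card, hm, hd]
    have n1 := hne a b hab e1
    have n2 := hne a c hac e2
    have n3 := hne b c hbc (e1.symm.trans e2)
    generalize (a : ℕ) / Y.card = x at *
    generalize (b : ℕ) / Y.card = y at *
    generalize (c : ℕ) / Y.card = z at *
    omega

/-- Ruzsa–Szemerédi graphs on `Λ ^ n` vertices with large minimum degree. -/
theorem exists_rsGraph_of_typicalPairs (μ : ℝ) {γ r' θ : ℕ} (hγ : 0 < γ) (hθ : 0 < θ)
    (hcount : (2 : ℤ) * ((((Λ ^ n : ℕ) : ℤ)) ^ 2 - (typicalPairs n Λ μ).card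
      + ((2 * Λ) ^ n : ℕ) * (2 * (16 * 8 ^ n * γ + r') : ℕ)) ≤ θ * (Λ ^ n : ℕ)) :
    ∃ (τ : ℕ) (H : RSGraph (Fin (Λ ^ n)) γ τ), ∀ v,
      r' * (Nat.card {w // ¬ H.graph.Adj v w} - (θ + 3)) ≤ 4 * (16 * 8 ^ n * γ * (2 * Λ) ^ n) := by
  -- A populous class must hold the reserve of `16 * 8 ^ n * γ` edges, the size `exists_blocks`
  -- needs for conflict degree `8 * 8 ^ n`, and `r'` more edges for balancing the load. The factor
  -- two accounts for ordered pairs.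
  set thr := 2 * (16 * 8 ^ n * γ + r') with hthr
  set N := Λ ^ n with hN
  obtain ⟨Y, hY1, hY2⟩ := exists_core (typicalPairs n Λ μ) pairSum typicalPairs_symm thr θ
  have hX : Fintype.card (Fin n → Fin Λ) = N := by simp [hN]
  have hS : Fintype.card (Fin n → Fin (2 * Λ)) = (2 * Λ) ^ n := by simp
  rw [hX, hS] at hY1
  have hYN : Y.card ≤ N := hX ▸ Finset.card_le_univ Y
  have hY3 : N ≤ 2 * Y.card := by
    have h1 : (θ : ℤ) * (2 * (N - Y.card)) ≤ θ * N := by linarith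
    have h2 := le_of_mul_le_mul_left h1 (by exact_mod_cast hθ)
    omega
  obtain ⟨π, hπY, hπsurj, hπ⟩ := exists_two_to_one hYN hY3
  let A : Finset (Fin n → Fin (2 * Λ)) :=
    Finset.univ.filter fun s => thr < (classPairs (typicalPairs n Λ μ) pairSum Y s).card
  let 𝓔 : Finset (Sym2 (Fin N)) := (typicalGraph π μ).edgeFinset.filter fun e => edgeSum π e ∈ A
  have h𝓔 : ∀ s ∈ A, (𝓔.filter fun e => edgeSum π e = s)
      = (typicalGraph π μ).edgeFinset.filter fun e => edgeSum π e = s := by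
    intro s hs
    ext e
    simp only [𝓔, Finset.mem_filter]
    constructor
    · rintro ⟨⟨h1, _⟩, h2⟩
      exact ⟨h1, h2⟩
    · rintro ⟨h1, rfl⟩
      exact ⟨⟨h1, hs⟩, rfl⟩
  have h𝓔G : ∀ e ∈ 𝓔, e ∈ (typicalGraph π μ).edgeSet := fun e he =>
    SimpleGraph.mem_edgeFinset.1 (Finset.mem_filter.1 he).1
  obtain ⟨R, hR𝓔, hRc, hRload⟩ := exists_subset_load_le 𝓔 (edgeSum π) A Sym2.toFinset
    (16 * 8 ^ n * γ) r' 2 (fun e he => (Finset.mem_filter.1 he).2)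
    (fun e => by
      induction e with | _ a b =>
      rw [Sym2.toFinset_mk_eq]
      exact Finset.card_le_two)
    (fun s v => card_edges_at_vertex_le hπ _ _ _)
    (fun s hs => by
      rw [h𝓔 s hs]
      have h1 := card_classPairs_le_edges (μ := μ) hπsurj s
      have h2 := (Finset.mem_filter.1 hs).2
      omega)
  have hblocks : ∀ s, ∃ 𝓑 : Finset (Finset (Sym2 (Fin N))), s ∈ A →
      (∀ B ∈ 𝓑, B ⊆ (𝓔.filter fun e => edgeSum π e = s) ∧ B.card = γ ∧
        (B : Set (Sym2 (Fin N))).Pairwise fun e f => ¬ CloseEdges π e f) ∧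
      (∀ B ∈ 𝓑, ∀ B' ∈ 𝓑, B ≠ B' → Disjoint B B') ∧
      ∀ e ∈ 𝓔, edgeSum π e = s → e ∉ R → ∃ B ∈ 𝓑, e ∈ B := by
    intro s
    by_cases hs : s ∈ A
    swap
    · exact ⟨∅, fun h => absurd h hs⟩
    have hsubR : (R.filter fun e => edgeSum π e = s) ⊆ 𝓔.filter fun e => edgeSum π e = s :=
      Finset.filter_subset_filter _ hR𝓔
    obtain ⟨𝓑, h1, h2, h3⟩ := exists_blocks (conf := CloseEdges π) closeEdges_refl closeEdges_symm
      hγ (M := 𝓔.filter fun e => edgeSum π e = s) (D := 8 * 8 ^ n)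
      (fun e _ => card_closeEdges_le hπ _ _ _) (8 * 8 ^ n)
      ((𝓔.filter fun e => edgeSum π e = s) \ (R.filter fun e => edgeSum π e = s))
      (R.filter fun e => edgeSum π e = s) Finset.sdiff_subset hsubR Finset.sdiff_disjoint
      (fun e _ => (Finset.card_le_card (Finset.filter_subset_filter _ Finset.sdiff_subset)).trans
        (card_closeEdges_le hπ 𝓔 s e))
      (by rw [hRc s hs]; exact le_of_eq (by ring))
    refine ⟨𝓑, fun _ => ⟨fun B hB => ?_, h2, fun e he hes heR => ?_⟩⟩
    · obtain ⟨h4, h5⟩ := h1 B hB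
      exact ⟨h4.trans (Finset.union_subset Finset.sdiff_subset hsubR), h5⟩
    · exact h3 e (by simp [he, hes, heR])
  choose 𝓑 h𝓑 using hblocks
  have hmem : ∀ B ∈ A.biUnion 𝓑, ∃ s ∈ A, B ∈ 𝓑 s := fun B hB => by simpa using hB
  have hBsum : ∀ s ∈ A, ∀ B ∈ 𝓑 s, ∀ e ∈ B, e ∈ 𝓔 ∧ edgeSum π e = s := fun s hs B hB e he =>
    Finset.mem_filter.1 (((h𝓑 s hs).1 B hB).1 he)
  obtain ⟨H, hH⟩ := exists_rsGraph_of_blocks (γ := γ) (typicalGraph π μ) (A.biUnion 𝓑)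
    (fun B hB => by
      obtain ⟨s, hs, hB⟩ := hmem B hB
      exact ((h𝓑 s hs).1 B hB).2.1)
    (fun B hB e he => by
      obtain ⟨s, hs, hB⟩ := hmem B hB
      exact h𝓔G e (hBsum s hs B hB e he).1)
    (fun B hB e he f hf hef a ha b hb => by
      obtain ⟨s, hs, hB⟩ := hmem B hB
      obtain ⟨he1, he2⟩ := hBsum s hs B hB e he
      obtain ⟨hf1, hf2⟩ := hBsum s hs B hB f hf
      exact not_adj_of_not_closeEdges (h𝓔G e he1) (h𝓔G f hf1) (he2.trans hf2.symm)
        (((h𝓑 s hs).1 B hB).2.2 he hf hef) ha hb)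
    (fun B hB B' hB' hne => by
      obtain ⟨s, hs, hB⟩ := hmem B hB
      obtain ⟨s', hs', hB'⟩ := hmem B' hB'
      by_cases hss : s = s'
      · subst hss
        exact (h𝓑 s hs).2.1 B hB B' hB' hne
      · refine Finset.disjoint_left.2 fun e he he' => hss ?_
        rw [← (hBsum s hs B hB e he).2, (hBsum s' hs' B' hB' e he').2])
  refine ⟨_, H, fun v => ?_⟩
  -- A non-neighbour `w` of `v` either has an image that is a bad partner in the core (including the
  -- image of `v` itself) or is joined to `v` by a reserve edge.
  have hnon : Nat.card {w // ¬ H.graph.Adj v w}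
      ≤ (θ + 1) + (R.filter fun e => v ∈ e.toFinset).card := by
    let Z := Y.filter fun y => ¬ ((π v, y) ∈ typicalPairs n Λ μ ∧
      thr < (classPairs (typicalPairs n Λ μ) pairSum Y (pairSum (π v, y))).card)
    have hZ : 2 * Z.card ≤ θ + 1 := hY2 (π v) (hπY v)
    have hZV : (Finset.univ.filter fun w => π w ∈ Z).card ≤ 2 * Z.card :=
      Finset.card_le_mul_card_image_of_maps_to (f := π)
        (fun w hw => (Finset.mem_filter.1 hw).2) 2 fun x _ =>
        (Finset.card_le_card (Finset.filter_subset_filter _ (Finset.filter_subset _ _))).trans (hπ x)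
    have hRV : (Finset.univ.filter fun w => s(v, w) ∈ R).card
        ≤ (R.filter fun e => v ∈ e.toFinset).card := by
      refine Finset.card_le_card_of_injOn (fun w => s(v, w)) (fun w hw => ?_)
        (fun w _ w' _ h => Sym2.congr_right.1 h)
      simpa using hw
    rw [Nat.card_eq_fintype_card, Fintype.card_subtype]
    refine (Finset.card_le_card (t := (Finset.univ.filter fun w => π w ∈ Z) ∪
      (Finset.univ.filter fun w => s(v, w) ∈ R)) ?_).trans ((Finset.card_union_le _ _).trans
        (Nat.add_le_add (hZV.trans hZ) hRV))
    intro w hw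
    simp only [Finset.mem_filter, Finset.mem_univ, true_and, Finset.mem_union] at hw ⊢
    by_contra! hcon
    obtain ⟨h1, h2⟩ := hcon
    apply hw
    have h3 : (π v, π w) ∈ typicalPairs n Λ μ ∧
        thr < (classPairs (typicalPairs n Λ μ) pairSum Y (pairSum (π v, π w))).card := by
      by_contra h
      exact h1 (Finset.mem_filter.2 ⟨hπY w, h⟩)
    have hsA : edgeSum π s(v, w) ∈ A := Finset.mem_filter.2 ⟨Finset.mem_univ _, h3.2⟩
    have hw𝓔 : s(v, w) ∈ 𝓔 :=
      Finset.mem_filter.2 ⟨SimpleGraph.mem_edgeFinset.2 h3.1, hsA⟩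
    obtain ⟨B, hB, hwB⟩ := (h𝓑 _ hsA).2.2 _ hw𝓔 rfl h2
    exact (hH v w).2 ⟨B, Finset.mem_biUnion.2 ⟨_, hsA, hB⟩, hwB⟩
  calc r' * (Nat.card {w // ¬ H.graph.Adj v w} - (θ + 3))
      ≤ r' * ((R.filter fun e => v ∈ e.toFinset).card - 2) := Nat.mul_le_mul_left _ (by omega)
    _ ≤ 2 * 2 * (16 * 8 ^ n * γ * A.card) := hRload v
    _ ≤ _ := by
      have hAc : A.card ≤ (2 * Λ) ^ n := hS ▸ Finset.card_le_univ A
      exact Nat.mul_le_mul_left _ (Nat.mul_le_mul_left _ hAc)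

end Geometry

/-! ### Concentration of the squared distance -/

/-- Exponential concentration, by counting, of a sum of bounded terms of mean zero. -/
theorem card_sum_gt_le {ι : Type} [Fintype ι] (n : ℕ) (Z : ι → ℝ) {B : ℝ} (hB : 1 ≤ B)
    (hZ : ∀ i, |Z i| ≤ B) (h0 : ∑ i, Z i = 0) :
    ((Finset.univ.filter fun ω : Fin n → ι => (n : ℝ) / 2 < ∑ k, Z (ω k)).card : ℝ)
      ≤ (Fintype.card ι : ℝ) ^ n * Real.exp (-(n / (16 * B ^ 2))) := by
  -- This minimises `t ^ 2 * B ^ 2 - t / 2`, the exponent per coordinate of the exponential moment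
  -- bound.
  set t : ℝ := 1 / (4 * B ^ 2) with ht
  have hB0 : 0 < B := by linarith
  have ht0 : 0 < t := by positivity
  have htB : t * B ≤ 1 := by
    rw [ht, div_mul_eq_mul_div, div_le_one (by positivity)]
    nlinarith
  have hone : ∑ i, Real.exp (t * Z i) ≤ Fintype.card ι * Real.exp (1 / (16 * B ^ 2)) := by
    have h1 : ∀ i, Real.exp (t * Z i) ≤ 1 + t * Z i + 1 / (16 * B ^ 2) := by
      intro i
      have h2 : |t * Z i| ≤ t * B := by
        rw [abs_mul, abs_of_pos ht0]
        exact mul_le_mul_of_nonneg_left (hZ i) ht0.le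
      have h3 := (abs_le.1 (Real.abs_exp_sub_one_sub_id_le (h2.trans htB))).2
      have h4 : (t * Z i) ^ 2 ≤ (t * B) ^ 2 := sq_le_sq.2 (h2.trans (le_abs_self _))
      have h5 : (t * B) ^ 2 = 1 / (16 * B ^ 2) := by
        rw [ht]; field_simp; norm_num
      linarith
    calc ∑ i, Real.exp (t * Z i) ≤ ∑ i, (1 + t * Z i + 1 / (16 * B ^ 2)) :=
          Finset.sum_le_sum fun i _ => h1 i
      _ = Fintype.card ι * (1 / (16 * B ^ 2) + 1) := by
          rw [Finset.sum_add_distrib, Finset.sum_add_distrib, ← Finset.mul_sum, h0]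
          simp; ring
      _ ≤ _ := by
          gcongr
          exact Real.add_one_le_exp _
  have hprod : ∑ ω : Fin n → ι, Real.exp (t * ∑ k, Z (ω k)) = (∑ i, Real.exp (t * Z i)) ^ n := by
    have := Finset.prod_univ_sum (fun _ : Fin n => (Finset.univ : Finset ι))
      (fun _ i => Real.exp (t * Z i))
    rw [Fintype.piFinset_univ] at this
    simp only [Finset.prod_const, Finset.card_univ, Fintype.card_fin] at this
    rw [this]
    simp only [Finset.mul_sum, Real.exp_sum]
  calc ((Finset.univ.filter fun ω : Fin n → ι => (n : ℝ) / 2 < ∑ k, Z (ω k)).card : ℝ)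
      = ∑ ω ∈ Finset.univ.filter fun ω : Fin n → ι => (n : ℝ) / 2 < ∑ k, Z (ω k), (1 : ℝ) := by
        simp
    _ ≤ ∑ ω ∈ Finset.univ.filter fun ω : Fin n → ι => (n : ℝ) / 2 < ∑ k, Z (ω k),
          Real.exp (-(t * (n / 2))) * Real.exp (t * ∑ k, Z (ω k)) := by
        refine Finset.sum_le_sum fun ω hω => ?_
        have := (Finset.mem_filter.1 hω).2
        rw [← Real.exp_add]
        apply Real.one_le_exp
        have := mul_le_mul_of_nonneg_left this.le ht0.le
        linarith
    _ ≤ ∑ ω : Fin n → ι, Real.exp (-(t * (n / 2))) * Real.exp (t * ∑ k, Z (ω k)) :=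
        Finset.sum_le_sum_of_subset_of_nonneg (Finset.filter_subset _ _)
          fun _ _ _ => by positivity
    _ = Real.exp (-(t * (n / 2))) * (∑ i, Real.exp (t * Z i)) ^ n := by
        rw [← Finset.mul_sum, hprod]
    _ ≤ Real.exp (-(t * (n / 2))) * (Fintype.card ι * Real.exp (1 / (16 * B ^ 2))) ^ n := by
        have : 0 ≤ ∑ i, Real.exp (t * Z i) := Finset.sum_nonneg fun _ _ => (Real.exp_pos _).le
        gcongr
    _ = _ := by
        rw [mul_pow, ← Real.exp_nat_mul, mul_left_comm, ← Real.exp_add]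
        congr 2
        rw [ht]; field_simp; ring

/-- Almost all pairs of grid points are at typical distance. -/
theorem exists_card_typicalPairs_ge (n : ℕ) {Λ : ℕ} (hΛ : 0 < Λ) :
    ∃ μ : ℝ, ((Λ ^ n : ℕ) : ℝ) ^ 2 - (typicalPairs n Λ μ).card
      ≤ (Λ ^ n : ℕ) + 2 * ((Λ ^ n : ℕ) : ℝ) ^ 2 * Real.exp (-(n / (16 * (Λ : ℝ) ^ 4))) := by
  let q : Fin Λ × Fin Λ → ℝ := fun p => ((p.1 : ℝ) - (p.2 : ℝ)) ^ 2
  have hΛ1 : (1 : ℝ) ≤ Λ := by exact_mod_cast hΛ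
  set ν : ℝ := (∑ p, q p) / (Λ : ℝ) ^ 2 with hν
  have hq0 : ∀ p, 0 ≤ q p := fun p => sq_nonneg _
  have hq1 : ∀ p, q p ≤ (Λ : ℝ) ^ 2 := by
    intro p
    have h1 : (p.1 : ℝ) ≤ Λ := by exact_mod_cast p.1.2.le
    have h2 : (p.2 : ℝ) ≤ Λ := by exact_mod_cast p.2.2.le
    have h3 : (0 : ℝ) ≤ (p.1 : ℕ) := Nat.cast_nonneg _
    have h4 : (0 : ℝ) ≤ (p.2 : ℕ) := Nat.cast_nonneg _
    apply sq_le_sq'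
    · linarith
    · linarith
  have hcard : Fintype.card (Fin Λ × Fin Λ) = Λ ^ 2 := by simp [sq]
  have hν0 : 0 ≤ ν := div_nonneg (Finset.sum_nonneg fun p _ => hq0 p) (by positivity)
  have hν1 : ν ≤ (Λ : ℝ) ^ 2 := by
    rw [hν, div_le_iff₀ (by positivity)]
    calc ∑ p, q p ≤ ∑ _p : Fin Λ × Fin Λ, (Λ : ℝ) ^ 2 := Finset.sum_le_sum fun p _ => hq1 p
      _ = _ := by rw [Finset.sum_const, Finset.card_univ, hcard]; simp
  have hsum : ∑ p, (q p - ν) = 0 := by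
    rw [Finset.sum_sub_distrib, Finset.sum_const, Finset.card_univ, hcard, hν]
    simp only [nsmul_eq_mul, Nat.cast_pow]
    field_simp
    ring
  have habs : ∀ p, |q p - ν| ≤ (Λ : ℝ) ^ 2 := fun p =>
    abs_le.2 ⟨by linarith [hq0 p], by linarith [hq1 p]⟩
  have hB : (1 : ℝ) ≤ (Λ : ℝ) ^ 2 := one_le_pow₀ hΛ1
  have hup := card_sum_gt_le n (fun p => q p - ν) hB habs hsum
  have hlo := card_sum_gt_le n (fun p => -(q p - ν)) hB (fun p => by rw [abs_neg]; exact habs p)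
    (by rw [Finset.sum_neg_distrib, hsum, neg_zero])
  rw [hcard] at hup hlo
  refine ⟨n * ν, ?_⟩
  let Φ := Equiv.arrowProdEquivProdArrow (Fin n) (fun _ => Fin Λ) (fun _ => Fin Λ)
  have hΦ : ∀ ω : Fin n → Fin Λ × Fin Λ, (sqDist (Φ ω).1 (Φ ω).2 : ℝ) - n * ν
      = ∑ k, (q (ω k) - ν) := by
    intro ω
    rw [Finset.sum_sub_distrib]
    simp [sqDist, q, Φ, Equiv.arrowProdEquivProdArrow]
  have hcover : (Finset.univ : Finset ((Fin n → Fin Λ) × (Fin n → Fin Λ))) ⊆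
      typicalPairs n Λ (n * ν) ∪ (Finset.univ.image (fun x => (x, x)) ∪
        ((Finset.univ.filter fun ω : Fin n → Fin Λ × Fin Λ =>
          (n : ℝ) / 2 < ∑ k, (q (ω k) - ν)).image Φ ∪
        (Finset.univ.filter fun ω : Fin n → Fin Λ × Fin Λ =>
          (n : ℝ) / 2 < ∑ k, -(q (ω k) - ν)).image Φ)) := by
    rintro ⟨x, y⟩ -
    obtain ⟨ω, hω⟩ := Φ.surjective (x, y)
    have h1 := hΦ ω
    rw [hω] at h1
    simp only [Finset.mem_union, Finset.mem_image, Finset.mem_univ, true_and, Finset.mem_filter,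
      typicalPairs]
    by_cases hxy : x = y
    · exact Or.inr (Or.inl ⟨x, by rw [hxy]⟩)
    by_cases h2 : (n : ℝ) / 2 < ∑ k, (q (ω k) - ν)
    · exact Or.inr (Or.inr (Or.inl ⟨ω, h2, hω⟩))
    by_cases h3 : (n : ℝ) / 2 < ∑ k, -(q (ω k) - ν)
    · exact Or.inr (Or.inr (Or.inr ⟨ω, h3, hω⟩))
    · rw [Finset.sum_neg_distrib] at h3
      refine Or.inl ⟨hxy, ?_⟩
      rw [h1, abs_le]
      constructor <;> linarith
  have hle := (Finset.card_le_card hcover).trans ((Finset.card_union_le _ _).trans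
    (Nat.add_le_add_left ((Finset.card_union_le _ _).trans (Nat.add_le_add Finset.card_image_le
      ((Finset.card_union_le _ _).trans
        (Nat.add_le_add Finset.card_image_le Finset.card_image_le)))) _))
  have hN : Fintype.card ((Fin n → Fin Λ) × (Fin n → Fin Λ)) = (Λ ^ n) ^ 2 := by simp [sq]
  have hN1 : Fintype.card (Fin n → Fin Λ) = Λ ^ n := by simp
  rw [Finset.card_univ, Finset.card_univ, hN, hN1] at hle
  have hle' : ((Λ ^ n : ℕ) : ℝ) ^ 2 ≤ (typicalPairs n Λ (n * ν)).card + ((Λ ^ n : ℕ) +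
      ((Finset.univ.filter fun ω : Fin n → Fin Λ × Fin Λ =>
          (n : ℝ) / 2 < ∑ k, (q (ω k) - ν)).card +
        (Finset.univ.filter fun ω : Fin n → Fin Λ × Fin Λ =>
          (n : ℝ) / 2 < ∑ k, -(q (ω k) - ν)).card)) := by
    exact_mod_cast hle
  have hpow : (((Λ ^ 2 : ℕ) : ℝ)) ^ n = ((Λ ^ n : ℕ) : ℝ) ^ 2 := by
    push_cast; ring
  rw [hpow, show ((Λ : ℝ) ^ 2) ^ 2 = (Λ : ℝ) ^ 4 by ring] at hup hlo
  linarith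

/-! ### Choice of parameters and asymptotics -/

/-- The size of the matchings. -/
noncomputable def matchingSize (Λ n : ℕ) : ℕ := ⌊((Λ ^ n : ℕ) : ℝ) / (2 * 110.25 ^ n)⌋₊

theorem matchingSize_le (Λ n : ℕ) :
    2 * (matchingSize Λ n : ℝ) ≤ ((Λ ^ n : ℕ) : ℝ) / 110.25 ^ n := by
  have := Nat.floor_le (a := ((Λ ^ n : ℕ) : ℝ) / (2 * 110.25 ^ n)) (by positivity)
  rw [matchingSize]
  calc _ ≤ 2 * (((Λ ^ n : ℕ) : ℝ) / (2 * 110.25 ^ n)) := by linarith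
    _ = _ := by field_simp

theorem lt_matchingSize (Λ n : ℕ) :
    ((Λ ^ n : ℕ) : ℝ) / 110.25 ^ n - 2 < 2 * (matchingSize Λ n : ℝ) := by
  have := Nat.lt_floor_add_one (((Λ ^ n : ℕ) : ℝ) / (2 * 110.25 ^ n))
  rw [matchingSize]
  have h : ((Λ ^ n : ℕ) : ℝ) / 110.25 ^ n = 2 * (((Λ ^ n : ℕ) : ℝ) / (2 * 110.25 ^ n)) := by
    field_simp
  rw [h]
  linarith

theorem tendsto_pow_div_atTop {Λ : ℕ} (hΛ : 111 ≤ Λ) :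
    Tendsto (fun n : ℕ => ((Λ ^ n : ℕ) : ℝ) / 110.25 ^ n) atTop atTop := by
  have h1 : (111 : ℝ) ≤ Λ := by exact_mod_cast hΛ
  have h2 : ∀ n : ℕ, ((Λ ^ n : ℕ) : ℝ) / 110.25 ^ n = ((Λ : ℝ) / 110.25) ^ n := by
    intro n
    rw [div_pow, Nat.cast_pow]
  simp only [h2]
  apply tendsto_pow_atTop_atTop_of_one_lt
  rw [one_lt_div (by norm_num)]
  linarith

theorem eventually_matchingSize_pos {Λ : ℕ} (hΛ : 111 ≤ Λ) :
    ∀ᶠ n in atTop, 0 < matchingSize Λ n := by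
  filter_upwards [(tendsto_pow_div_atTop hΛ).eventually_ge_atTop 2] with n hn
  have := lt_matchingSize Λ n
  have h2 : (0 : ℝ) < matchingSize Λ n := by linarith
  exact_mod_cast h2

/-- Collects the error terms of the construction. The third is where the base matters: `2 ^ n` from
the number of classes and `16 ^ n` from the threshold must be beaten by the `110.25 ^ n` in the
matching size, and `32 * 1.3 ^ 4 < 110.25`. -/
theorem eventually_geometric_le {Λ : ℕ} (hΛ : 111 ≤ Λ) {w y : ℝ} (hw1 : 1 < w) (hw : w ≤ 1.3)
    (hy : 0 < y) (hwy : w ^ 2 * y < 1) :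
    ∀ᶠ n : ℕ in atTop,
      4 * (w ^ 2 / Λ) ^ n + 8 * (w ^ 2 * y) ^ n + 640 * (32 * w ^ 4 / 110.25) ^ n ≤ 1 ∧
        w⁻¹ ^ n + 2 * (w / Λ) ^ n ≤ 1 := by
  have h1 : (111 : ℝ) ≤ Λ := by exact_mod_cast hΛ
  have hw0 : 0 < w := by linarith
  have hw2 : w ^ 2 ≤ 1.3 ^ 2 := by gcongr
  have hw4 : w ^ 4 ≤ 1.3 ^ 4 := by gcongr
  have t1 : Tendsto (fun n : ℕ => (w ^ 2 / Λ) ^ n) atTop (nhds 0) :=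
    tendsto_pow_atTop_nhds_zero_of_lt_one (by positivity)
      (by rw [div_lt_one (by linarith)]; norm_num at hw2; linarith)
  have t2 : Tendsto (fun n : ℕ => (w ^ 2 * y) ^ n) atTop (nhds 0) :=
    tendsto_pow_atTop_nhds_zero_of_lt_one (by positivity) hwy
  have t3 : Tendsto (fun n : ℕ => (32 * w ^ 4 / 110.25) ^ n) atTop (nhds 0) :=
    tendsto_pow_atTop_nhds_zero_of_lt_one (by positivity)
      (by rw [div_lt_one (by norm_num)]; norm_num at hw4 ⊢; linarith)
  have t4 : Tendsto (fun n : ℕ => w⁻¹ ^ n) atTop (nhds 0) :=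
    tendsto_pow_atTop_nhds_zero_of_lt_one (by positivity) (inv_lt_one_of_one_lt₀ hw1)
  have t5 : Tendsto (fun n : ℕ => (w / Λ) ^ n) atTop (nhds 0) :=
    tendsto_pow_atTop_nhds_zero_of_lt_one (by positivity)
      (by rw [div_lt_one (by linarith)]; linarith)
  have s1 := ((t1.const_mul 4).add (t2.const_mul 8)).add (t3.const_mul 640)
  have s2 := t4.add (t5.const_mul 2)
  simp only [mul_zero, add_zero] at s1 s2
  exact (s1.eventually_le_const one_pos).and (s2.eventually_le_const one_pos)

/-- For large `n` there are Ruzsa–Szemerédi graphs on `Λ ^ n` vertices with matchings of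
`matchingSize Λ n` edges in which every vertex has few non-neighbours. -/
theorem eventually_exists_rsGraph {Λ : ℕ} (hΛ : 111 ≤ Λ) :
    ∀ᶠ n : ℕ in atTop, ∃ (τ : ℕ) (H : RSGraph (Fin (Λ ^ n)) (matchingSize Λ n) τ), ∀ v,
      (Nat.card {w // ¬ H.graph.Adj v w} : ℝ)
        ≤ 2 * (Λ ^ n : ℕ) * Real.exp (-(n / (100 * (Λ : ℝ) ^ 4))) := by
  have hΛ' : (111 : ℝ) ≤ Λ := by exact_mod_cast hΛ
  have hΛ4 : (1 : ℝ) ≤ (Λ : ℝ) ^ 4 := one_le_pow₀ (by linarith)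
  -- The rate `1 / 100` is small enough that `w ^ 2` still loses against the concentration rate `1 /
  -- 16` in `y`.
  set w : ℝ := Real.exp (1 / (100 * (Λ : ℝ) ^ 4)) with hw
  set y : ℝ := Real.exp (-(1 / (16 * (Λ : ℝ) ^ 4))) with hy
  have hw1 : 1 < w := Real.one_lt_exp_iff.2 (by positivity)
  have hw2 : w ≤ 1.3 := by
    have h1 : 1 / (100 * (Λ : ℝ) ^ 4) ≤ 0.01 := by
      rw [div_le_iff₀ (by positivity)]
      linarith
    have h2 : (0 : ℝ) ≤ 1 / (100 * (Λ : ℝ) ^ 4) := by positivity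
    have h3 := Real.abs_exp_sub_one_le (x := 1 / (100 * (Λ : ℝ) ^ 4))
      (by rw [abs_of_nonneg h2]; linarith)
    rw [abs_of_nonneg h2] at h3
    have := (abs_le.1 h3).2
    rw [← hw] at this
    linarith
  have hwy : w ^ 2 * y < 1 := by
    rw [hw, hy, ← Real.exp_nat_mul, ← Real.exp_add, Real.exp_lt_one_iff]
    have : ((2 : ℕ) : ℝ) * (1 / (100 * (Λ : ℝ) ^ 4)) + -(1 / (16 * (Λ : ℝ) ^ 4))
        = -(17 / (400 * (Λ : ℝ) ^ 4)) := by
      field_simp; norm_num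
    rw [this, neg_lt_zero]
    positivity
  filter_upwards [eventually_geometric_le hΛ hw1 hw2 (Real.exp_pos _) hwy,
    eventually_matchingSize_pos hΛ] with n hgeo hγ
  obtain ⟨hg1, hg2⟩ := hgeo
  set γ := matchingSize Λ n with hγdef
  set N : ℝ := ((Λ ^ n : ℕ) : ℝ) with hN
  have hNpos : 0 < N := by
    rw [hN]; exact_mod_cast Nat.pow_pos (by omega)
  have hN' : N = (Λ : ℝ) ^ n := by rw [hN, Nat.cast_pow]
  set W : ℝ := w ^ n with hW
  have hW1 : 1 ≤ W := one_le_pow₀ hw1.le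
  have hWexp : Real.exp (-(n / (100 * (Λ : ℝ) ^ 4))) = W⁻¹ := by
    rw [hW, hw, ← Real.exp_nat_mul, ← Real.exp_neg]
    congr 1; ring
  have hYexp : Real.exp (-(n / (16 * (Λ : ℝ) ^ 4))) = y ^ n := by
    rw [hy, ← Real.exp_nat_mul]
    congr 1; ring
  have hg1' : 4 * (W ^ 2 / N) + 8 * (W ^ 2 * y ^ n) + 640 * (32 ^ n * W ^ 4 / 110.25 ^ n) ≤ 1 := by
    have e1 : (w ^ 2 / (Λ : ℝ)) ^ n = W ^ 2 / N := by rw [hN', hW, div_pow]; ring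
    have e2 : (w ^ 2 * y) ^ n = W ^ 2 * y ^ n := by rw [hW, mul_pow]; ring
    have e3 : (32 * w ^ 4 / 110.25) ^ n = 32 ^ n * W ^ 4 / 110.25 ^ n := by
      rw [hW, div_pow, mul_pow]; ring
    rwa [e1, e2, e3] at hg1
  have hg2' : W⁻¹ + 2 * (W / N) ≤ 1 := by
    have e1 : (w / (Λ : ℝ)) ^ n = W / N := by rw [hN', hW, div_pow]
    rwa [inv_pow, e1] at hg2
  -- Both losses at a vertex, bad partners and reserve edges, are aimed at `N / t`, about `N / W ^
  -- 2`. The spare factor `W` absorbs the additive constants in the final bound `2 * N / W`.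
  set t := ⌈W ^ 2⌉₊ with ht
  have hW2 : 1 ≤ W ^ 2 := one_le_pow₀ hW1
  have ht1 : W ^ 2 ≤ t := Nat.le_ceil _
  have ht2 : (t : ℝ) ≤ 2 * W ^ 2 := by
    have := Nat.ceil_lt_add_one (a := W ^ 2) (by positivity)
    linarith
  have ht0 : (0 : ℝ) < t := by linarith
  set θ := ⌈N / t⌉₊ with hθ
  have hθ1 : N / t ≤ θ := Nat.le_ceil _
  have hθ2 : (θ : ℝ) ≤ N / t + 1 := (Nat.ceil_lt_add_one (by positivity)).le
  have hθ0 : 0 < θ := Nat.ceil_pos.2 (by positivity)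
  have hγle : 2 * (γ : ℝ) ≤ N / 110.25 ^ n := matchingSize_le Λ n
  obtain ⟨μ, hμ⟩ := exists_card_typicalPairs_ge n (show 0 < Λ by omega)
  rw [hYexp, ← hN] at hμ
  have hcount : 2 * (N ^ 2 - (typicalPairs n Λ μ).card
      + ((2 : ℝ) * Λ) ^ n * (2 * (16 * 8 ^ n * γ + 64 * 16 ^ n * γ * t))) ≤ θ * N := by
    have h1 : (2 * (16 * 8 ^ n * γ + 64 * 16 ^ n * γ * t) : ℝ)
        ≤ 160 * 16 ^ n * W ^ 2 * (N / 110.25 ^ n) := by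
      have h2 : (8 : ℝ) ^ n ≤ 16 ^ n * t := by
        calc (8 : ℝ) ^ n ≤ 16 ^ n * 1 := by
              rw [mul_one]; exact pow_le_pow_left₀ (by norm_num) (by norm_num) n
          _ ≤ 16 ^ n * t := by gcongr; linarith
      calc (2 * (16 * 8 ^ n * γ + 64 * 16 ^ n * γ * t) : ℝ)
          = (2 * γ) * (16 * 8 ^ n + 64 * (16 ^ n * t)) := by ring
        _ ≤ (2 * γ) * (80 * (16 ^ n * (2 * W ^ 2))) := by
            refine mul_le_mul_of_nonneg_left ?_ (by positivity)
            have : (16 : ℝ) ^ n * t ≤ 16 ^ n * (2 * W ^ 2) := by gcongr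
            linarith
        _ ≤ (N / 110.25 ^ n) * (80 * (16 ^ n * (2 * W ^ 2))) := by gcongr
        _ = _ := by ring
    have h3 : ((2 : ℝ) * Λ) ^ n * (160 * 16 ^ n * W ^ 2 * (N / 110.25 ^ n))
        = 160 * (32 ^ n * W ^ 4 / 110.25 ^ n) * (N ^ 2 / W ^ 2) := by
      have : (32 : ℝ) ^ n = 2 ^ n * 16 ^ n := by rw [← mul_pow]; norm_num
      rw [mul_pow, ← hN', this]
      field_simp
    have h4 : N ^ 2 / (2 * W ^ 2) ≤ θ * N := by
      calc N ^ 2 / (2 * W ^ 2) ≤ N ^ 2 / t := by gcongr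
        _ = N / t * N := by ring
        _ ≤ θ * N := by gcongr
    have h5 : ((2 : ℝ) * Λ) ^ n * (2 * (16 * 8 ^ n * γ + 64 * 16 ^ n * γ * t))
        ≤ 160 * (32 ^ n * W ^ 4 / 110.25 ^ n) * (N ^ 2 / W ^ 2) := by
      rw [← h3]
      gcongr
    have h6 := mul_le_mul_of_nonneg_right hg1' (show 0 ≤ N ^ 2 / (2 * W ^ 2) by positivity)
    have h7 : (4 * (W ^ 2 / N) + 8 * (W ^ 2 * y ^ n) + 640 * (32 ^ n * W ^ 4 / 110.25 ^ n))
        * (N ^ 2 / (2 * W ^ 2)) = 2 * N + 4 * N ^ 2 * y ^ n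
          + 320 * (32 ^ n * W ^ 4 / 110.25 ^ n) * (N ^ 2 / W ^ 2) := by
      field_simp
      ring
    rw [h7, one_mul] at h6
    linarith
  -- This `r'` is `t` times the factor `64 * 16 ^ n * γ` of the load bound, so cancelling that
  -- factor leaves `t * (x - (θ + 3)) ≤ Λ ^ n`.
  obtain ⟨τ, H, hH⟩ := exists_rsGraph_of_typicalPairs (n := n) (Λ := Λ) μ
    (r' := 64 * 16 ^ n * γ * t) hγ hθ0 (by
      have : ((2 * (((Λ ^ n : ℕ) : ℤ) ^ 2 - (typicalPairs n Λ μ).card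
        + ((2 * Λ) ^ n : ℕ) * (2 * (16 * 8 ^ n * γ + 64 * 16 ^ n * γ * t) : ℕ)) : ℤ) : ℝ)
        ≤ ((θ * (Λ ^ n : ℕ) : ℤ) : ℝ) := by
        push_cast
        push_cast at hN
        rw [← hN]
        exact hcount
      exact_mod_cast this)
  refine ⟨τ, H, fun v => ?_⟩
  have h1 := hH v
  set x := Nat.card {w // ¬ H.graph.Adj v w} with hx
  have h2 : t * (x - (θ + 3)) ≤ Λ ^ n := by
    have e1 : 64 * 16 ^ n * γ * t * (x - (θ + 3))
        = (64 * 16 ^ n * γ) * (t * (x - (θ + 3))) := by ring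
    have e2 : 4 * (16 * 8 ^ n * γ * (2 * Λ) ^ n) = (64 * 16 ^ n * γ) * Λ ^ n := by
      have : (16 : ℕ) ^ n = 8 ^ n * 2 ^ n := by rw [← mul_pow]; norm_num
      rw [this, mul_pow]; ring
    rw [e1, e2] at h1
    exact Nat.le_of_mul_le_mul_left h1 (by positivity)
  have h3 : (t : ℝ) * ((x : ℝ) - (θ + 3)) ≤ N := by
    have h4 : (x : ℝ) - (θ + 3) ≤ ((x - (θ + 3) : ℕ) : ℝ) := by
      rw [sub_le_iff_le_add]
      exact_mod_cast (le_tsub_add : x ≤ x - (θ + 3) + (θ + 3))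
    calc (t : ℝ) * ((x : ℝ) - (θ + 3)) ≤ t * ((x - (θ + 3) : ℕ) : ℝ) := by gcongr
      _ ≤ N := by rw [hN]; exact_mod_cast h2
  have h5 : (x : ℝ) - (θ + 3) ≤ N / t := by
    rw [le_div_iff₀ ht0]; linarith
  have h6 : N / t ≤ N / W ^ 2 := by gcongr
  rw [hWexp]
  have h7 := mul_le_mul_of_nonneg_left hg2' (show 0 ≤ 2 * N * W⁻¹ by positivity)
  have h8 : 2 * N * W⁻¹ * (W⁻¹ + 2 * (W / N)) = 2 * (N / W ^ 2) + 4 := by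
    field_simp
    ring
  rw [h8, mul_one] at h7
  linarith

/-- The throughput is asymptotically optimal if the graphs are nearly complete. -/
theorem tendsto_rsThroughput_ratio {Λ : ℕ} (hΛ : 111 ≤ Λ) {τ : ℕ → ℕ} {b : ℕ → ℝ}
    (hb : Tendsto b atTop (nhds 0))
    (hlow : ∀ᶠ n in atTop, ((Λ ^ n : ℕ) : ℝ) ^ 2 * (1 - b n) ≤ 2 * matchingSize Λ n * τ n)
    (hup : ∀ᶠ n in atTop, 2 * (matchingSize Λ n : ℝ) * τ n ≤ ((Λ ^ n : ℕ) : ℝ) ^ 2)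
    {C : ℝ} {κ : ℕ} (hC : 0 < C) (hκ : 0 < κ) :
    Tendsto (fun n => rsThroughput C κ (Λ ^ n) (matchingSize Λ n) (τ n)
      / (C / κ * (110.25 ^ n)⁻¹)) atTop (nhds 1) := by
  have hq := tendsto_pow_div_atTop hΛ
  have hκ' : (0 : ℝ) < κ := by exact_mod_cast hκ
  have hNpos : ∀ n : ℕ, (0 : ℝ) < ((Λ ^ n : ℕ) : ℝ) := fun n => by
    exact_mod_cast Nat.pow_pos (by omega)
  -- Up to the prefactor `C / κ`, the throughput is `(2γ - 1) / N` divided by the edge density `2γτ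
  -- / N ^ 2`. The density tends to one, and `2γ - 1` is within `3` of `N / 110.25 ^ n`.
  have lim1 : Tendsto (fun n => (2 * (matchingSize Λ n : ℝ) * τ n) / ((Λ ^ n : ℕ) : ℝ) ^ 2)
      atTop (nhds 1) := by
    have hb1 : Tendsto (fun n => 1 - b n) atTop (nhds 1) := by
      simpa using hb.const_sub 1
    refine tendsto_of_tendsto_of_tendsto_of_le_of_le' hb1 tendsto_const_nhds ?_ ?_
    · filter_upwards [hlow] with n hn
      rw [le_div_iff₀ (pow_pos (hNpos n) 2)]
      linarith
    · filter_upwards [hup] with n hn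
      rw [div_le_one (pow_pos (hNpos n) 2)]
      exact hn
  have lim2 : Tendsto (fun n => (2 * (matchingSize Λ n : ℝ) - 1)
      / (((Λ ^ n : ℕ) : ℝ) / 110.25 ^ n)) atTop (nhds 1) := by
    have hb1 : Tendsto (fun n : ℕ => 1 - 3 / (((Λ ^ n : ℕ) : ℝ) / 110.25 ^ n)) atTop (nhds 1) := by
      simpa using (hq.const_div_atTop 3).const_sub 1
    have hpos : ∀ n : ℕ, (0 : ℝ) < ((Λ ^ n : ℕ) : ℝ) / 110.25 ^ n := fun n =>
      div_pos (hNpos n) (by positivity)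
    refine tendsto_of_tendsto_of_tendsto_of_le_of_le hb1 tendsto_const_nhds ?_ ?_
    · intro n
      simp only
      rw [le_div_iff₀ (hpos n), sub_mul, div_mul_cancel₀ _ (hpos n).ne']
      linarith [lt_matchingSize Λ n]
    · intro n
      simp only
      rw [div_le_one (hpos n)]
      linarith [matchingSize_le Λ n]
  have lim := lim2.div lim1 one_ne_zero
  rw [div_one] at lim
  refine lim.congr' ?_
  filter_upwards [eventually_matchingSize_pos hΛ, lim1.eventually_const_lt one_half_lt_one]
    with n hγ hτ
  have hγ' : (1 : ℝ) ≤ matchingSize Λ n := by exact_mod_cast hγ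
  have hγ2 : (2 * (matchingSize Λ n : ℝ) - 1) ≠ 0 := by linarith
  have hτ0 : (τ n : ℝ) ≠ 0 := by
    intro h
    rw [h] at hτ
    norm_num at hτ
  have hN0 := (hNpos n).ne'
  simp only [Pi.div_apply, rsThroughput]
  field_simp

end D2D

/-! ### Constants and assembly -/

theorem corollary2 :
    ∃ c₁ c₂ : ℝ, 0 < c₁ ∧ 0 < c₂ ∧
      ∀ (Λ : ℕ) (δ : ℝ), (10.5 : ℝ) ^ 2 < Λ → δ = 2 * Real.log 10.5 / Real.log Λ →
        ∃ (γ τ : ℕ → ℕ) (H : ∀ z : ℕ, D2D.RSGraph (Fin (Λ ^ z)) (γ z) (τ z)),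
          -- packetization `K = (2γ - 1) g_c = O(g_c ^ (2 - δ))`, where `g_c = Λ ^ z`
          (fun z : ℕ => ((Fintype.card (Fin (Λ ^ z) × Fin (2 * γ z - 1)) : ℕ) : ℝ))
            =O[atTop] (fun z : ℕ => ((Λ ^ z : ℕ) : ℝ) ^ (2 - δ)) ∧
          -- the throughput is `(C / 𝒦) g_c ^ (-δ) + o((C / 𝒦) g_c ^ (-δ))`
          (∀ (C : ℝ) (𝒦 : ℕ), 0 < C → 0 < 𝒦 →
            (fun z : ℕ => D2D.rsThroughput C 𝒦 (Λ ^ z) (γ z) (τ z)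
                - C / 𝒦 * ((Λ ^ z : ℕ) : ℝ) ^ (-δ))
              =o[atTop] (fun z : ℕ => C / 𝒦 * ((Λ ^ z : ℕ) : ℝ) ^ (-δ))) ∧
          -- and it is achieved, in every network, once the cluster size is large enough
          ∀ᶠ z : ℕ in atTop, ∀ (s c 𝒦 m : ℕ) (r Δ C M : ℝ)
            (cl : D2D.Clustering s c (Λ ^ z) r) (col : Fin c → Fin 𝒦),
            0 < s → 0 < r → r < √2 → 0 < Δ → 0 < C →
            D2D.IsReuse Δ cl col →
            M = 2 * m * ((Λ ^ z : ℕ) : ℝ) ^ (-(c₁ * δ * Real.exp (-c₂ / δ))) →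
            2 ≤ ((Λ ^ z : ℕ) : ℝ) * M / m →
            ∀ T : ℝ, T < D2D.rsThroughput C 𝒦 (Λ ^ z) (γ z) (τ z) →
              D2D.ThroughputAchievable s r Δ C (Fin (Λ ^ z) × Fin (2 * γ z - 1)) m
                (D2D.IsClusteredRS cl (H z) m) M T := by
  have hlog : 0 < Real.log 10.5 := Real.log_pos (by norm_num)
  -- With these constants `exp (-c₂ / δ) = Λ ^ (-4)` and `c₁ * δ = 1 / (100 * log Λ)`, so the power
  -- of `g_c` in `M` is exactly `exp (-(z / (100 * Λ ^ 4)))`, the bound on the proportion of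
  -- non-neighbours.
  refine ⟨1 / (200 * Real.log 10.5), 8 * Real.log 10.5, by positivity, by positivity, ?_⟩
  intro Λ δ hΛ hδ
  have hΛ1 : 111 ≤ Λ := by
    have h1 : (110 : ℝ) < Λ := lt_trans (by norm_num) hΛ
    have h2 : 110 < Λ := by exact_mod_cast h1
    omega
  have hΛ0 : (0 : ℝ) < Λ := by exact_mod_cast (by omega : 0 < Λ)
  have hlogΛ : 0 < Real.log Λ := Real.log_pos (by exact_mod_cast (by omega : 1 < Λ))
  have hrpow : ∀ (z : ℕ) (a : ℝ), ((Λ ^ z : ℕ) : ℝ) ^ a = Real.exp (z * Real.log Λ * a) := by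
    intro z a
    rw [Real.rpow_def_of_pos (by positivity), Nat.cast_pow, Real.log_pow]
  have hδpow : ∀ z : ℕ, ((Λ ^ z : ℕ) : ℝ) ^ (-δ) = ((110.25 : ℝ) ^ z)⁻¹ := by
    intro z
    rw [hrpow, hδ, show (z * Real.log Λ * -(2 * Real.log 10.5 / Real.log Λ) : ℝ)
      = -((2 * z : ℕ) * Real.log 10.5) by push_cast; field_simp, Real.exp_neg, Real.exp_nat_mul,
      Real.exp_log (by norm_num), pow_mul]
    norm_num
  have hMpow : ∀ z : ℕ, ((Λ ^ z : ℕ) : ℝ) ^ (-(1 / (200 * Real.log 10.5) * δ *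
      Real.exp (-(8 * Real.log 10.5) / δ))) = Real.exp (-(z / (100 * (Λ : ℝ) ^ 4))) := by
    intro z
    have h1 : Real.exp (-(8 * Real.log 10.5) / δ) = ((Λ : ℝ) ^ 4)⁻¹ := by
      rw [hδ, show (-(8 * Real.log 10.5) / (2 * Real.log 10.5 / Real.log Λ) : ℝ)
        = -((4 : ℕ) * Real.log Λ) by push_cast; field_simp; norm_num, Real.exp_neg,
        Real.exp_nat_mul, Real.exp_log hΛ0]
    rw [hrpow, h1, hδ]
    congr 1
    field_simp
    ring
  let good : ℕ → Prop := fun z =>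
    ∃ (τ : ℕ) (H : D2D.RSGraph (Fin (Λ ^ z)) (D2D.matchingSize Λ z) τ), ∀ v,
      (Nat.card {w // ¬ H.graph.Adj v w} : ℝ)
        ≤ 2 * (Λ ^ z : ℕ) * Real.exp (-(z / (100 * (Λ : ℝ) ^ 4)))
  have hgood : ∀ᶠ z in atTop, good z := D2D.eventually_exists_rsGraph hΛ1
  have hex : ∀ z, ∃ (γ τ : ℕ) (H : D2D.RSGraph (Fin (Λ ^ z)) γ τ), good z →
      γ = D2D.matchingSize Λ z ∧ ∀ v, (Nat.card {w // ¬ H.graph.Adj v w} : ℝ)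
        ≤ 2 * (Λ ^ z : ℕ) * Real.exp (-(z / (100 * (Λ : ℝ) ^ 4))) := by
    intro z
    by_cases h : good z
    · obtain ⟨τ, H, hH⟩ := h
      exact ⟨_, τ, H, fun _ => ⟨rfl, hH⟩⟩
    -- For the finitely many other `z` an edgeless graph with no matchings serves as a default.
    · obtain ⟨H, -⟩ := D2D.exists_rsGraph_of_blocks (γ := 0) (⊥ : SimpleGraph (Fin (Λ ^ z))) ∅
        (by simp) (by simp) (by simp) (by simp)
      exact ⟨0, _, H, fun h' => absurd h' h⟩
  choose γ τ H hH using hex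
  refine ⟨γ, τ, H, ?_, ?_, ?_⟩
  · refine IsBigO.of_bound 1 ?_
    filter_upwards [hgood] with z hz
    have hN : (0 : ℝ) < ((Λ ^ z : ℕ) : ℝ) := by positivity
    rw [one_mul, Real.norm_of_nonneg (by positivity), Real.norm_of_nonneg (by positivity),
      Fintype.card_prod, Fintype.card_fin, Fintype.card_fin, Nat.cast_mul,
      sub_eq_add_neg, Real.rpow_add hN, hδpow, Real.rpow_two, sq, mul_assoc, (hH z hz).1]
    refine mul_le_mul_of_nonneg_left ?_ hN.le
    calc ((2 * D2D.matchingSize Λ z - 1 : ℕ) : ℝ) ≤ ((2 * D2D.matchingSize Λ z : ℕ) : ℝ) := by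
          exact_mod_cast Nat.sub_le _ _
      _ ≤ _ := by
          push_cast
          have := D2D.matchingSize_le Λ z
          rw [div_eq_mul_inv] at this
          exact_mod_cast this
  · intro C κ hC hκ
    simp only [hδpow]
    have hκ' : (0 : ℝ) < κ := by exact_mod_cast hκ
    have hsum : ∀ z, (2 * γ z * τ z : ℝ)
        = ∑ v, (((Λ ^ z : ℕ) : ℝ) - Nat.card {w // ¬ (H z).graph.Adj v w}) := by
      intro z
      have h1 := (H z).sum_card_matchings
      simp only [(H z).card_matchings_eq] at h1
      have h2 : ∀ v, (Nat.card {w // (H z).graph.Adj v w} : ℝ)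
          = ((Λ ^ z : ℕ) : ℝ) - Nat.card {w // ¬ (H z).graph.Adj v w} := by
        intro v
        rw [eq_sub_iff_add_eq, Nat.card_eq_fintype_card, Nat.card_eq_fintype_card]
        have := Fintype.card_subtype_compl (fun w => (H z).graph.Adj v w)
        have h3 := Fintype.card_subtype_le (fun w => (H z).graph.Adj v w)
        rw [Fintype.card_fin] at this h3
        rw [this, Nat.cast_sub h3]
        ring
      simp only [← h2]
      exact_mod_cast h1.symm
    have hb : Tendsto (fun z : ℕ => 2 * Real.exp (-(z / (100 * (Λ : ℝ) ^ 4)))) atTop (nhds 0) := by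
      have : Tendsto (fun z : ℕ => (z : ℝ) / (100 * (Λ : ℝ) ^ 4)) atTop atTop :=
        tendsto_natCast_atTop_atTop.atTop_div_const (by positivity)
      simpa using ((Real.tendsto_exp_neg_atTop_nhds_zero.comp this).const_mul 2)
    have key := D2D.tendsto_rsThroughput_ratio hΛ1 (τ := τ) hb
      (by
        filter_upwards [hgood] with z hz
        rw [← (hH z hz).1, hsum]
        calc ((Λ ^ z : ℕ) : ℝ) ^ 2 * (1 - 2 * Real.exp (-(z / (100 * (Λ : ℝ) ^ 4))))
            = ∑ _v : Fin (Λ ^ z), (((Λ ^ z : ℕ) : ℝ)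
              - 2 * (Λ ^ z : ℕ) * Real.exp (-(z / (100 * (Λ : ℝ) ^ 4)))) := by
              rw [Finset.sum_const, Finset.card_univ, Fintype.card_fin, nsmul_eq_mul]
              ring
          _ ≤ _ := Finset.sum_le_sum fun v _ => sub_le_sub_left ((hH z hz).2 v) _)
      (by
        filter_upwards [hgood] with z hz
        rw [← (hH z hz).1, hsum]
        calc ∑ v, (((Λ ^ z : ℕ) : ℝ) - Nat.card {w // ¬ (H z).graph.Adj v w})
            ≤ ∑ _v : Fin (Λ ^ z), ((Λ ^ z : ℕ) : ℝ) :=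
              Finset.sum_le_sum fun v _ => sub_le_self _ (Nat.cast_nonneg _)
          _ = _ := by
              rw [Finset.sum_const, Finset.card_univ, Fintype.card_fin, nsmul_eq_mul, sq]) hC hκ
    refine IsEquivalent.isLittleO (u := fun z => D2D.rsThroughput C κ (Λ ^ z) (γ z) (τ z))
      ((isEquivalent_iff_tendsto_one (Eventually.of_forall fun z => by positivity)).2 ?_)
    refine key.congr' ?_
    filter_upwards [hgood] with z hz
    rw [← (hH z hz).1]
    rfl
  · filter_upwards [hgood, D2D.eventually_matchingSize_pos hΛ1] with z hz hpos
    intro s c κ m r Δ C M cl col _ _ _ _ hC hcol hM _ T hT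
    rw [hMpow] at hM
    refine D2D.throughputAchievable_rs cl hcol (H z) ((hH z hz).1 ▸ hpos)
      (Nat.pow_pos (by omega)) hC (fun v => ?_) hT
    calc (m * Nat.card {w // ¬ (H z).graph.Adj v w} : ℝ)
        ≤ m * (2 * (Λ ^ z : ℕ) * Real.exp (-(z / (100 * (Λ : ℝ) ^ 4)))) := by
          gcongr
          exact (hH z hz).2 v
      _ = M * (Λ ^ z : ℕ) := by rw [hM]; ring
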